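/- Let $\mathcal H$ be a complex Hilbert space and let $A:\mathcal H\to\mathcal H$ be a bounded linear operator that is coercive, i.e. for some $C_{\rm coer}>0$, $|(A\psi,\psi)|\ge C_{\rm coer}\|\psi\|^2$ for all $\psi\in\mathcal H$. Let $(\mathcal H_N)_N$ be a sequence of finite-dimensional subspaces of $\mathcal H$, not all zero, with bases $\{\psi^N_1,\dots,\psi^N_{M_N}\}$, $M_N=\dim\mathcal H_N$. For $\mathbf w\in\mathbb C^{M_N}$ write $w_N=\sum_{j}w_j\psi^N_j$. Suppose that there are diagonal matrices $\mathsf D_N$ with positive diagonal entries and constants $C_1,C_2>0$, independent of $N$, such that $$C_1\|\mathsf D_N^{1/2}\mathbf w\|_2\le\|w_N\|_{\mathcal H}\le C_2\|\mathsf D_N^{1/2}\mathbf w\|_2\qquad\text{for all }\mathbf w\in\mathbb C^{M_N}\text{ and all }N.$$ Then there is a unique $\beta\in[0,\pi/2)$ with $$\cos\beta=\frac{C_{\rm coer}}{\|A\|}\Big(\frac{C_1}{C_2}\Big)^2;\qquad\text{put}\quad \gamma_\beta:=2\sin\Big(\frac{\beta}{4-2\beta/\pi}\Big).$$ For $f\in\mathcal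 H$ let $\mathsf A_{ij}=(A\psi^N_j,\psi^N_i)$ and $b_i=(f,\psi^N_i)$ be the Galerkin matrix and right-hand side, and put $\mathsf C=\mathsf D_N^{-1/2}\mathsf A\mathsf D_N^{-1/2}$, $\mathbf d=\mathsf D_N^{-1/2}\mathbf b$. For $m\ge1$ the $m$th GMRES iterate $\mathbf y_m$ for $\mathsf C\mathbf y=\mathbf d$ with zero initial guess, i.e. the minimizer of $\|\mathsf C\mathbf z-\mathbf d\|_2$ over $\mathbf z\in\mathrm{span}\{\mathsf C^j\mathbf d:0\le j<m\}$, exists and is unique. Let $\phi_N^m=\sum_j(\mathsf D_N^{-1/2}\mathbf y_m)_j\psi^N_j$. Let $\varepsilon>0$ and let $m\ge1$ be an integer with $$m\ge\Big(\log\frac1{\gamma_\beta}\Big)^{-1}\left[\log\left(\frac{12\|A\|}{C_{\rm coer}}\Big(\frac{C_2}{C_1}\Big)^3\right)+\log\frac1\varepsilon\right]$$ (the right-hand side is read as $0$ if $\gamma_\beta=0$). Then for all $N$ and all $\phi\ne0$ and $f$ in $\mathcal H$ with $A\phi=f$, $$\frac{\|\phi-\phi_N^m\|_{\mathcal H}}{\|\phi\|_{\mathcal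 H}}\le(1+\varepsilon)\frac{\|A\|}{C_{\rm coer}}\min_{\psi\in\mathcal H_N}\frac{\|\phi-\psi\|_{\mathcal H}}{\|\phi\|_{\mathcal H}}+\varepsilon .$$ In particular the bound on $m$ depends only on $\|A\|/C_{\rm coer}$, $C_2/C_1$ and $\varepsilon$, and not on $N$ or $M_N$. -/

import Mathlib

open Real

noncomputable section

namespace GalerkinGMRES

/-- The Euclidean norm of a vector in `ℂⁿ`. -/
def norm2 {n : ℕ} (v : Fin n → ℂ) : ℝ := ‖WithLp.toLp 2 v‖

/-- The Krylov space spanned by `C ^ j r` for `j = 0, …, m - 1`. -/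
def krylov {n : ℕ} (C : Matrix (Fin n) (Fin n) ℂ) (r : Fin n → ℂ) (m : ℕ) :
    Submodule ℂ (Fin n → ℂ) :=
  Submodule.span ℂ {v | ∃ j : ℕ, j < m ∧ v = (C ^ j).mulVec r}

/-- `y` is an `m`-th GMRES iterate for `C x = d` with zero initial guess: it lies in the `m`-th Krylov
space of the initial residual `r₀ = C 0 - d`, and its residual has minimal Euclidean norm there. -/
def IsGMRESIterate {n : ℕ} (C : Matrix (Fin n) (Fin n) ℂ) (d : Fin n → ℂ) (m : ℕ)
    (y : Fin n → ℂ) : Prop :=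
  y ∈ krylov C (C.mulVec 0 - d) m ∧
    ∀ z ∈ krylov C (C.mulVec 0 - d) m, norm2 (C.mulVec y - d) ≤ norm2 (C.mulVec z - d)

/-- `D ^ (1/2)`, where `D` is the diagonal matrix with diagonal entries `d j > 0`. -/
def sqrtDiag {n : ℕ} (d : Fin n → ℝ) : Matrix (Fin n) (Fin n) ℂ :=
  Matrix.diagonal fun j => ((√(d j) : ℝ) : ℂ)

/-- `D ^ (-1/2)`, where `D` is the diagonal matrix with diagonal entries `d j > 0`. -/
def invSqrtDiag {n : ℕ} (d : Fin n → ℝ) : Matrix (Fin n) (Fin n) ℂ :=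
  Matrix.diagonal fun j => (((√(d j))⁻¹ : ℝ) : ℂ)

section Hilbert

variable {H : Type*} [NormedAddCommGroup H] [InnerProductSpace ℂ H]

/-- `A` is coercive with constant `c`. -/
def IsCoerciveWith (A : H →L[ℂ] H) (c : ℝ) : Prop :=
  0 < c ∧ ∀ ψ : H, c * ‖ψ‖ ^ 2 ≤ ‖inner ℂ ψ (A ψ)‖

/-- The element `∑ j, v j • ψ j` of the subspace with basis `ψ`, regarded as an element of `H`. -/
def synth {n : ℕ} {V : Submodule ℂ H} (ψ : Module.Basis (Fin n) ℂ V) (v : Fin n → ℂ) : H :=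
  ∑ j, v j • (ψ j : H)

/-- The Galerkin matrix, with entries `(A ψ_j, ψ_i)`, where `( , )` is linear in the
first argument; `inner ℂ` is linear in the second. -/
def galerkinMatrix {n : ℕ} {V : Submodule ℂ H} (A : H →L[ℂ] H)
    (ψ : Module.Basis (Fin n) ℂ V) : Matrix (Fin n) (Fin n) ℂ :=
  Matrix.of fun i j => inner ℂ (ψ i : H) (A (ψ j : H))

/-- The Galerkin right-hand side, with entries `(f, ψ_i)`. -/
def galerkinRhs {n : ℕ} {V : Submodule ℂ H} (f : H) (ψ : Module.Basis (Fin n) ℂ V) :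
    Fin n → ℂ :=
  fun i => inner ℂ (ψ i : H) f

/-- The diagonally scaled Galerkin matrix `D ^ (-1/2) A D ^ (-1/2)`. -/
def scaledMatrix {n : ℕ} {V : Submodule ℂ H} (A : H →L[ℂ] H)
    (ψ : Module.Basis (Fin n) ℂ V) (d : Fin n → ℝ) : Matrix (Fin n) (Fin n) ℂ :=
  invSqrtDiag d * galerkinMatrix A ψ * invSqrtDiag d

/-- The diagonally scaled right-hand side `D ^ (-1/2) b`. -/
def scaledRhs {n : ℕ} {V : Submodule ℂ H} (f : H) (ψ : Module.Basis (Fin n) ℂ V)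
    (d : Fin n → ℝ) : Fin n → ℂ :=
  (invSqrtDiag d).mulVec (galerkinRhs f ψ)

/-- The norm equivalence, with the positive diagonal matrices `D N = diag (d N)` and with positive
constants `C₁`, `C₂` that do not depend on `N`. -/
def NormEquivalence {M : ℕ → ℕ} {V : ℕ → Submodule ℂ H}
    (ψ : ∀ N, Module.Basis (Fin (M N)) ℂ (V N)) (d : ∀ N, Fin (M N) → ℝ) (C₁ C₂ : ℝ) : Prop :=
  0 < C₁ ∧ 0 < C₂ ∧ (∀ N j, 0 < d N j) ∧
    ∀ N (w : Fin (M N) → ℂ),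
      C₁ * norm2 ((sqrtDiag (d N)).mulVec w) ≤ ‖synth (ψ N) w‖ ∧
        ‖synth (ψ N) w‖ ≤ C₂ * norm2 ((sqrtDiag (d N)).mulVec w)

end Hilbert

/-- `γ_β = 2 sin (β / (4 - 2 β / π))`. -/
def gammaRate (β : ℝ) : ℝ := 2 * Real.sin (β / (4 - 2 * β / π))

/-- The bound on the number of iterations; `q` stands for `‖A‖ / C_coer` and `κ` for `C₂ / C₁`.
For `β = 0` one has `γ_β = 0`, and `(log (1 / γ_β))⁻¹` takes its limiting value `0`. -/
def iterationBound (β q κ ε : ℝ) : ℝ :=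
  (Real.log (1 / gammaRate β))⁻¹ * (Real.log (12 * q * κ ^ 3) + Real.log (1 / ε))

end GalerkinGMRES

end

open GalerkinGMRES

/-! In scaled coefficients the Galerkin matrix `C` is the compression of `A` to the subspace, so the
norm equivalence gives `‖C‖ ≤ ‖A‖ C₂²` and keeps the numerical range of `C` at distance at least
`Ccoer C₁²` from the origin. That range is convex (Toeplitz–Hausdorff), so a rotation and a division
by `‖A‖ C₂²` produce a contraction `T` whose numerical range lies in the lens `{|z| ≤ 1, cos β ≤ re
z}`. A GMRES residual is at most `‖p(T) d‖` for every polynomial `p` of degree at most `m` with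
`p(0) = 1`; it remains to find one with `‖p(T)‖ ≤ 12 γ ^ m`.

The choice is the normalised Faber polynomial `F_m` of the lens. The `F_m(z)` are the Taylor
coefficients in `u` of `w Ψ'(w) / (Ψ(w) - z)`, `w = 1 / u`, with `Ψ` the exterior conformal map,
which is elementary in the coordinate of a vertical strip. For `z` in the lens this generating
function has nonnegative real part (`LensParams.lensKernel_re_nonneg`); the property passes to
quadratic forms of operators, and Carathéodory's inequality bounds the numerical radius of `F_m(T)`
by 2, hence its norm by 4 (`LensParams.norm_inner_lensFaber_le`, `norm_apply_le_of_norm_inner_le`).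

At `z = 0` the generating function has a simple pole at `u = γ`. Subtracting `(γ + u) / (2 (γ - u))`
leaves a function with nonnegative real part and value `1/2` at the centre, so `|F_m(0) - γ⁻ᵐ| ≤ 1`
(`LensParams.norm_eval_lensFaber_sub_le`). Both positivity statements are checked on the edges of
the strip and carried inside by Phragmén–Lindelöf. Dividing yields `4 / (γ⁻ᵐ - 1)`, which is at most
`12 γ ^ m` as soon as `12 γ ^ m < 1`.

Coercivity of `C` turns the residual bound into a bound for the distance to the Galerkin solution,
and Céa's lemma does the rest. -/

/-! ### Taylor coefficients of holomorphic functions. -/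

open Complex Metric Filter Topology ComplexConjugate in
/-- Carathéodory's coefficient inequality for holomorphic functions with nonnegative real part. -/
theorem norm_iteratedDeriv_le_of_re_nonneg {g : ℂ → ℂ} (hg : DifferentiableOn ℂ g (ball 0 1))
    (hpos : ∀ z ∈ ball (0 : ℂ) 1, 0 ≤ (g z).re) {n : ℕ} (hn : 1 ≤ n) :
    ‖iteratedDeriv n g 0 / n.factorial‖ ≤ 2 * (g 0).re := by
  set A : ℂ := iteratedDeriv n g 0 / n.factorial with hA
  have key : ∀ r ∈ Set.Ioo (0 : ℝ) 1, r ^ n * ‖A‖ ≤ 2 * (g 0).re := by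
    intro r ⟨hr0, hr1⟩
    have hsub : closedBall (0 : ℂ) r ⊆ ball 0 1 := closedBall_subset_ball hr1
    have hgr : DifferentiableOn ℂ g (closedBall 0 r) := hg.mono hsub
    have hcs : sphere (0 : ℂ) |r| ⊆ closedBall 0 r := by
      rw [abs_of_pos hr0]; exact sphere_subset_closedBall
    have hgc : ContinuousOn g (sphere 0 |r|) := hgr.continuousOn.mono hcs
    have hd : ∀ f : ℂ → ℂ, DifferentiableOn ℂ f (closedBall 0 r) →
        circleAverage f 0 r = f 0 := fun f hf => by
      apply DiffContOnCl.circleAverage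
      rw [abs_of_pos hr0]
      exact (hf.mono closure_ball_subset_closedBall).diffContOnCl
    have h1 : circleAverage g 0 r = g 0 := hd g hgr
    have h2 : circleAverage (fun z => z ^ n * g z) 0 r = 0 := by
      rw [hd _ (by fun_prop)]
      simp [show n ≠ 0 by omega]
    have h3 : circleAverage (fun z => conj (z ^ n) * g z) 0 r = r ^ (2 * n) * A := by
      have h4 := hgr.circleIntegral_one_div_sub_center_pow_smul hr0 n
      have h5 : circleAverage (fun z => (z ^ n)⁻¹ * g z) 0 r = A := by
        rw [circleAverage_eq_circleIntegral hr0.ne']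
        have : (∮ z in C(0, r), (z - 0)⁻¹ • ((z ^ n)⁻¹ * g z)) =
            ∮ z in C(0, r), (1 / (z - 0) ^ (n + 1)) • g z := by
          congr 1; ext z; simp [pow_succ]; ring
        rw [this, h4, hA]
        simp only [smul_eq_mul]
        have : (π : ℂ) ≠ 0 := by exact_mod_cast Real.pi_ne_zero
        field_simp
      rw [← h5, ← smul_eq_mul, ← circleAverage_smul]
      apply circleAverage_congr_sphere
      intro z hz
      have hz' : ‖z‖ = r := by simpa [abs_of_pos hr0] using hz
      have hz0 : z ≠ 0 := by rw [← norm_pos_iff, hz']; exact hr0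
      have : conj (z ^ n) = (r : ℂ) ^ (2 * n) * (z ^ n)⁻¹ := by
        rw [eq_mul_inv_iff_mul_eq₀ (pow_ne_zero _ hz0), map_pow, ← mul_pow, conj_mul', hz',
          pow_mul]
      simp only [this, Pi.smul_apply, smul_eq_mul]
      ring
    have h6 : circleAverage (fun z => conj (z ^ n) * conj (g z)) 0 r = 0 := by
      have hci : CircleIntegrable (fun z => z ^ n * g z) 0 r :=
        ContinuousOn.circleIntegrable' (by fun_prop)
      have := (conjCLE : ℂ →L[ℝ] ℂ).circleAverage_comp_comm hci
      simpa [Function.comp_def, h2] using this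
    -- Adding the vanishing average `h6` replaces `g` by `2 re g`. Nonnegativity then lets the
    -- modulus pass under the integral without losing the mean value `re (g 0)`.
    have h7 : circleAverage (fun z => conj (z ^ n) * (2 * (g z).re : ℝ)) 0 r
        = r ^ (2 * n) * A := by
      have : (fun z => conj (z ^ n) * ((2 * (g z).re : ℝ) : ℂ)) =
          fun z => conj (z ^ n) * g z + conj (z ^ n) * conj (g z) := by
        ext z; rw [← mul_add, add_conj]
      rw [this, circleAverage_fun_add, h3, h6, add_zero]
      · exact ContinuousOn.circleIntegrable'
          (((continuous_conj.comp (continuous_pow n)).continuousOn).mul hgc)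
      · exact ContinuousOn.circleIntegrable'
          (((continuous_conj.comp (continuous_pow n)).continuousOn).mul
            (continuous_conj.comp_continuousOn hgc))
    have h8 : circleAverage (fun z => (g z).re) 0 r = (g 0).re := by
      have := reCLM.circleAverage_comp_comm
        (f := g) (c := 0) (R := r) (ContinuousOn.circleIntegrable' hgc)
      simpa [Function.comp_def, h1] using this
    have h9 : ‖circleAverage (fun z => conj (z ^ n) * (2 * (g z).re : ℝ)) 0 r‖
        ≤ r ^ n * (2 * (g 0).re) := by
      rw [← h8, circleAverage_def, circleAverage_def, norm_smul, smul_eq_mul,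
        Real.norm_of_nonneg (by positivity)]
      have hint : IntervalIntegrable (fun θ => (g (circleMap 0 r θ)).re) MeasureTheory.volume
          0 (2 * π) := by
        refine ContinuousOn.intervalIntegrable ?_
        refine continuous_re.comp_continuousOn (hgc.comp (by fun_prop) ?_)
        intro θ _; simp
      have := intervalIntegral.norm_integral_le_of_norm_le (μ := MeasureTheory.volume)
        (f := fun θ => conj ((circleMap 0 r θ) ^ n) * ((2 * (g (circleMap 0 r θ)).re : ℝ) : ℂ))
        (g := fun θ => r ^ n * (2 * (g (circleMap 0 r θ)).re))
        Real.two_pi_pos.le (Eventually.of_forall fun θ _ => by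
          rw [norm_mul, norm_conj, norm_pow, norm_circleMap_zero, abs_of_pos hr0, norm_real,
            Real.norm_of_nonneg]
          have := hpos (circleMap 0 r θ) (hsub (circleMap_mem_closedBall _ hr0.le _))
          linarith) ((hint.const_mul 2).const_mul _)
      rw [intervalIntegral.integral_const_mul, intervalIntegral.integral_const_mul] at this
      calc _ ≤ (2 * π)⁻¹ * _ := mul_le_mul_of_nonneg_left this (by positivity)
        _ = _ := by ring
    rw [h7, norm_mul, norm_pow, norm_real, Real.norm_of_nonneg hr0.le, two_mul, pow_add,
      mul_assoc] at h9
    exact le_of_mul_le_mul_left h9 (pow_pos hr0 n)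
  have hlim : Tendsto (fun r : ℝ => r ^ n * ‖A‖) (𝓝[<] 1) (𝓝 ‖A‖) := by
    have : Tendsto (fun r : ℝ => r ^ n * ‖A‖) (𝓝 1) (𝓝 (1 ^ n * ‖A‖)) :=
      Continuous.tendsto (by fun_prop) _
    simpa using this.mono_left nhdsWithin_le_nhds
  refine le_of_tendsto hlim ?_
  filter_upwards [Ioo_mem_nhdsLT (show (0 : ℝ) < 1 by norm_num)] with r hr
  exact key r hr

open Filter Topology in
/-- Taylor coefficients of a function that agrees with a combination of the functions `c j` up to
a multiple of the power `τ ^ (n + 1)` of a function vanishing at the centre. -/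
theorem iteratedDeriv_eq_sum_of_eventuallyEq {n : ℕ} {g τ e : ℂ → ℂ} {c : ℕ → ℂ → ℂ} {s : ℕ → ℂ}
    (hτ : AnalyticAt ℂ τ 0) (hτ0 : τ 0 = 0) (he : AnalyticAt ℂ e 0)
    (hc : ∀ j, AnalyticAt ℂ (c j) 0)
    (h : g =ᶠ[𝓝 0] fun u => ∑ j ∈ Finset.range (n + 1), c j u * s j + τ u ^ (n + 1) * e u) :
    iteratedDeriv n g 0 = ∑ j ∈ Finset.range (n + 1), iteratedDeriv n (c j) 0 * s j := by
  rw [h.iteratedDeriv_eq]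
  have hq : AnalyticAt ℂ (fun u => τ u ^ (n + 1) * e u) 0 := (hτ.pow _).mul he
  have h0 : iteratedDeriv n (fun u => τ u ^ (n + 1) * e u) 0 = 0 := by
    refine (natCast_le_analyticOrderAt_iff_iteratedDeriv_eq_zero (n := n + 1) hq).1 ?_ n (by omega)
    have h1 : analyticOrderAt (fun u => τ u ^ (n + 1) * e u) 0
        = (n + 1) • analyticOrderAt τ 0 + analyticOrderAt e 0 := by
      rw [← analyticOrderAt_pow hτ]; exact analyticOrderAt_mul (hτ.pow _) he
    rw [h1]
    have h2 : 1 ≤ analyticOrderAt τ 0 := by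
      rw [Order.one_le_iff_ne_zero]; exact fun h => (hτ.analyticOrderAt_eq_zero.1 h) hτ0
    calc ((n + 1 : ℕ) : ℕ∞) = (n + 1) • 1 := by simp
      _ ≤ (n + 1) • analyticOrderAt τ 0 := nsmul_le_nsmul_right h2 _
      _ ≤ _ := le_self_add
  have hcd : ∀ j ∈ Finset.range (n + 1), ContDiffAt ℂ n (fun u => c j u * s j) 0 :=
    fun j _ => ((hc j).mul analyticAt_const).contDiffAt
  have hsum : ContDiffAt ℂ n (fun u => ∑ j ∈ Finset.range (n + 1), c j u * s j) 0 :=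
    ContDiffAt.sum hcd
  have := iteratedDeriv_add hsum (hq.contDiffAt (n := n))
  rw [Pi.add_def] at this
  rw [this, h0, add_zero, iteratedDeriv_fun_sum hcd]
  exact Finset.sum_congr rfl fun j _ => by rw [iteratedDeriv_mul_const_field]

/-! ### Growth and zeros of the complex sine and cosine. -/

theorem Complex.norm_sin_le_exp (z : ℂ) : ‖Complex.sin z‖ ≤ Real.exp |z.im| := by
  have h : Complex.sin z = (Complex.exp (-z * I) - Complex.exp (z * I)) * I / 2 := rfl
  rw [h, norm_div, norm_mul, Complex.norm_I, mul_one, Complex.norm_ofNat]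
  have h1 := norm_sub_le (Complex.exp (-z * I)) (Complex.exp (z * I))
  simp only [Complex.norm_exp] at h1
  have e1 : (-z * I).re = z.im := by simp
  have e2 : (z * I).re = -z.im := by simp
  rw [e1, e2] at h1
  have := Real.exp_le_exp.2 (le_abs_self z.im)
  have := Real.exp_le_exp.2 (neg_le_abs z.im)
  linarith

theorem Complex.sinh_abs_im_le_norm_sin (z : ℂ) : Real.sinh |z.im| ≤ ‖Complex.sin z‖ := by
  have h : Complex.sin z = (Complex.exp (-z * I) - Complex.exp (z * I)) * I / 2 := rfl
  rw [h, norm_div, norm_mul, Complex.norm_I, mul_one, Complex.norm_ofNat, Real.sinh_eq]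
  have h1 := abs_norm_sub_norm_le (Complex.exp (-z * I)) (Complex.exp (z * I))
  simp only [Complex.norm_exp] at h1
  have e1 : (-z * I).re = z.im := by simp
  have e2 : (z * I).re = -z.im := by simp
  rw [e1, e2] at h1
  have h2 := abs_le.1 h1
  rcases abs_cases z.im with ⟨h, -⟩ | ⟨h, -⟩ <;> rw [h]
  · linarith [h2.2]
  · rw [neg_neg]; linarith [h2.1]

theorem Complex.cos_eq_sin_add (z : ℂ) : Complex.cos z = Complex.sin (z + (π / 2 : ℝ)) := by
  rw [Complex.ofReal_div, Complex.ofReal_ofNat, Complex.sin_add_pi_div_two]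

theorem Complex.norm_cos_le_exp (z : ℂ) : ‖Complex.cos z‖ ≤ Real.exp |z.im| := by
  rw [Complex.cos_eq_sin_add]; simpa using Complex.norm_sin_le_exp (z + (π / 2 : ℝ))

theorem Complex.sinh_abs_im_le_norm_cos (z : ℂ) : Real.sinh |z.im| ≤ ‖Complex.cos z‖ := by
  rw [Complex.cos_eq_sin_add]; simpa using Complex.sinh_abs_im_le_norm_sin (z + (π / 2 : ℝ))

theorem Real.exp_div_four_le_sinh {t : ℝ} (ht : 1 ≤ t) : Real.exp t / 4 ≤ Real.sinh t := by
  rw [Real.sinh_eq]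
  have h1 : 2 ≤ Real.exp t := by linarith [Real.add_one_le_exp t]
  have h2 : Real.exp (-t) * Real.exp t = 1 := by rw [← Real.exp_add]; simp
  have h3 := Real.exp_pos (-t)
  nlinarith

theorem Complex.exp_div_four_le_norm_sin {z : ℂ} (hz : 1 ≤ |z.im|) :
    Real.exp |z.im| / 4 ≤ ‖Complex.sin z‖ :=
  (Real.exp_div_four_le_sinh hz).trans (Complex.sinh_abs_im_le_norm_sin z)

theorem Complex.exp_div_four_le_norm_cos {z : ℂ} (hz : 1 ≤ |z.im|) :
    Real.exp |z.im| / 4 ≤ ‖Complex.cos z‖ :=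
  (Real.exp_div_four_le_sinh hz).trans (Complex.sinh_abs_im_le_norm_cos z)

theorem Complex.sin_ne_zero_of_abs_re_lt_pi {z : ℂ} (h0 : z ≠ 0) (hz : |z.re| < π) :
    Complex.sin z ≠ 0 := by
  intro h
  obtain ⟨k, hk⟩ := Complex.sin_eq_zero_iff.1 h
  rw [hk] at hz
  have h1 : |(k : ℝ)| * π < π := by
    have : ((k : ℂ) * π).re = k * π := by simp
    rwa [this, abs_mul, abs_of_pos Real.pi_pos] at hz
  have h2 : |(k : ℝ)| < 1 := by
    by_contra hcon
    push Not at hcon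
    nlinarith [Real.pi_pos]
  have h3 : k = 0 := by
    have : |k| < 1 := by exact_mod_cast h2
    exact Int.abs_lt_one_iff.1 this
  exact h0 (by rw [hk, h3]; simp)

theorem Complex.cos_ne_zero_of_abs_re_lt {z : ℂ} (hz : |z.re| < π / 2) : Complex.cos z ≠ 0 := by
  rw [Complex.cos_eq_sin_add]
  have h := abs_lt.1 hz
  have hre : (z + (π / 2 : ℝ)).re = z.re + π / 2 := by simp
  refine Complex.sin_ne_zero_of_abs_re_lt_pi ?_ ?_
  · intro h0
    have := congrArg Complex.re h0
    rw [hre, Complex.zero_re] at this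
    linarith
  · rw [hre, abs_lt]; constructor <;> linarith

/-- The real part of the cotangent. -/
theorem Complex.re_cos_div_sin (z : ℂ) :
    (Complex.cos z / Complex.sin z).re
      = Real.sin (2 * z.re) / (Real.cosh (2 * z.im) - Real.cos (2 * z.re)) := by
  obtain ⟨x, y⟩ := z
  have hz : (⟨x, y⟩ : ℂ) = x + y * Complex.I := by simp [Complex.ext_iff]
  have hs : Complex.sin ⟨x, y⟩
      = ⟨Real.sin x * Real.cosh y, Real.cos x * Real.sinh y⟩ := by
    rw [hz, Complex.sin_add_mul_I, ← Complex.ofReal_sin, ← Complex.ofReal_cos,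
      ← Complex.ofReal_sinh, ← Complex.ofReal_cosh]
    simp [Complex.ext_iff, Complex.sin_ofReal_re, Complex.cos_ofReal_re, Complex.sinh_ofReal_re]
  have hc : Complex.cos ⟨x, y⟩
      = ⟨Real.cos x * Real.cosh y, -(Real.sin x * Real.sinh y)⟩ := by
    rw [hz, Complex.cos_add_mul_I, ← Complex.ofReal_sin, ← Complex.ofReal_cos,
      ← Complex.ofReal_sinh, ← Complex.ofReal_cosh]
    simp [Complex.ext_iff, Complex.sin_ofReal_re, Complex.cos_ofReal_re, Complex.sinh_ofReal_re]
  rw [hs, hc, Complex.div_re, Complex.normSq_mk]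
  have h1 := Real.sin_sq_add_cos_sq x
  have h2 := Real.cosh_sq y
  have h3 : Real.cosh (2 * y) - Real.cos (2 * x) =
      2 * (Real.sin x * Real.cosh y * (Real.sin x * Real.cosh y) +
        Real.cos x * Real.sinh y * (Real.cos x * Real.sinh y)) := by
    rw [Real.cosh_two_mul, Real.cos_two_mul]
    linear_combination -(2 * Real.cosh y ^ 2) * h1 + (2 * Real.cos x ^ 2 - 1) * h2
  rw [h3, Real.sin_two_mul, ← add_div, mul_assoc 2, mul_div_mul_left _ _ two_ne_zero]
  congr 1
  linear_combination (Real.sin x * Real.cos x) * h2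

/-! ### The quotient of sines and its logarithmic derivative. -/

/-- `sin (a x) / sin x`, with the singularity at the origin removed. -/
noncomputable def sinRatio (a : ℝ) (x : ℂ) : ℂ :=
  dslope (fun z => Complex.sin (a * z)) 0 x / dslope Complex.sin 0 x

theorem sinRatio_of_ne_zero (a : ℝ) {x : ℂ} (hx : x ≠ 0) :
    sinRatio a x = Complex.sin (a * x) / Complex.sin x := by
  simp only [sinRatio, dslope_of_ne _ hx, slope_def_field, sub_zero, mul_zero, Complex.sin_zero]
  exact div_div_div_cancel_right₀ hx _ _

theorem hasDerivAt_sin_mul (a : ℝ) (x : ℂ) :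
    HasDerivAt (fun z : ℂ => Complex.sin (a * z)) (Complex.cos (a * x) * a) x := by
  have := ((hasDerivAt_id x).const_mul (a : ℂ)).csin
  simpa using this

theorem sinRatio_zero (a : ℝ) : sinRatio a 0 = a := by
  simp only [sinRatio, dslope_same, (hasDerivAt_sin_mul a 0).deriv, Complex.deriv_sin]
  simp

theorem dslope_sin_ne_zero {x : ℂ} (hx : |x.re| < π) : dslope Complex.sin 0 x ≠ 0 := by
  rcases eq_or_ne x 0 with rfl | h0
  · simp [Complex.deriv_sin]
  · rw [dslope_of_ne _ h0, slope_def_field]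
    simpa using ⟨Complex.sin_ne_zero_of_abs_re_lt_pi h0 hx, h0⟩

theorem differentiable_dslope {f : ℂ → ℂ} (hf : Differentiable ℂ f) :
    Differentiable ℂ (dslope f 0) := by
  rw [← differentiableOn_univ] at hf ⊢
  exact (Complex.differentiableOn_dslope Filter.univ_mem).2 hf

theorem differentiableAt_sinRatio (a : ℝ) {x : ℂ} (hx : |x.re| < π) :
    DifferentiableAt ℂ (sinRatio a) x :=
  (differentiable_dslope (by fun_prop) x).div
    (differentiable_dslope Complex.differentiable_sin x) (dslope_sin_ne_zero hx)

theorem sinRatio_ne_zero {a : ℝ} (ha : 1 ≤ a) {x : ℂ} (hx : a * |x.re| < π) :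
    sinRatio a x ≠ 0 := by
  rcases eq_or_ne x 0 with rfl | h0
  · rw [sinRatio_zero]; exact_mod_cast (by linarith : a ≠ 0)
  · rw [sinRatio_of_ne_zero a h0]
    have h1 : |x.re| < π := by nlinarith [abs_nonneg x.re]
    refine div_ne_zero (Complex.sin_ne_zero_of_abs_re_lt_pi ?_ ?_)
      (Complex.sin_ne_zero_of_abs_re_lt_pi h0 h1)
    · exact mul_ne_zero (by exact_mod_cast (by linarith : a ≠ 0)) h0
    · rwa [Complex.re_ofReal_mul, abs_mul, abs_of_pos (by linarith : 0 < a)]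

theorem logDeriv_sinRatio {a : ℝ} (ha : 1 ≤ a) {x : ℂ} (h0 : x ≠ 0) (hx : a * |x.re| < π) :
    logDeriv (sinRatio a) x =
      a * (Complex.cos (a * x) / Complex.sin (a * x)) - Complex.cos x / Complex.sin x := by
  have h1 : |x.re| < π := by nlinarith [abs_nonneg x.re]
  have hs : Complex.sin x ≠ 0 := Complex.sin_ne_zero_of_abs_re_lt_pi h0 h1
  have hsa : Complex.sin (a * x) ≠ 0 := by
    refine Complex.sin_ne_zero_of_abs_re_lt_pi ?_ ?_
    · exact mul_ne_zero (by exact_mod_cast (by linarith : a ≠ 0)) h0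
    · rwa [Complex.re_ofReal_mul, abs_mul, abs_of_pos (by linarith : 0 < a)]
  have he : sinRatio a =ᶠ[nhds x] fun z => Complex.sin (a * z) / Complex.sin z := by
    filter_upwards [isOpen_ne.mem_nhds h0] with z hz
    exact sinRatio_of_ne_zero a hz
  have hd := (hasDerivAt_sin_mul a x).div (Complex.hasDerivAt_sin x) hs
  have hd' : deriv (sinRatio a) x = _ := he.deriv_eq.trans hd.deriv
  rw [logDeriv_apply, hd', sinRatio_of_ne_zero a h0]
  field_simp

theorem differentiableAt_logDeriv_sinRatio {a : ℝ} (ha : 1 ≤ a) {x : ℂ} (hx : a * |x.re| < π) :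
    DifferentiableAt ℂ (logDeriv (sinRatio a)) x := by
  have hopen : IsOpen {z : ℂ | |z.re| < π} :=
    isOpen_lt (continuous_abs.comp Complex.continuous_re) continuous_const
  have hx1 : |x.re| < π := by nlinarith [abs_nonneg x.re]
  have hd : DifferentiableOn ℂ (sinRatio a) {z : ℂ | |z.re| < π} :=
    fun z hz => (differentiableAt_sinRatio a hz).differentiableWithinAt
  exact ((hd.deriv hopen).differentiableAt (hopen.mem_nhds hx1)).div
    (differentiableAt_sinRatio a hx1) (sinRatio_ne_zero ha hx)

/-! ### The lens and the strip. -/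

/-- The parameters of the lens `{|z| ≤ 1, cos β ≤ re z}`: its corners have exterior angle `a π`. -/
structure LensParams (β a θ : ℝ) : Prop where
  pos : 0 < β
  lt : β < π / 2
  mul_pi : a * π = 2 * π - β
  eq : β = 2 * a * θ

namespace LensParams

variable {β a θ : ℝ} (h : LensParams β a θ)
include h

theorem one_lt : 1 < a := by
  have := h.mul_pi; have := h.lt; have := Real.pi_pos
  by_contra hc
  push Not at hc
  nlinarith

theorem lt_two : a < 2 := by
  have := h.mul_pi; have := h.pos; have := Real.pi_pos
  by_contra hc
  push Not at hc
  nlinarith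

theorem theta_pos : 0 < θ := by
  have := h.eq; have := h.pos; have := h.one_lt
  by_contra hc
  push Not at hc
  nlinarith

/-- The limiting case is `β = π / 2`, `a = 3 / 2`. The bound gives `2 sin θ < 1`, and `2 θ < π / 4 +
θ / 2`, so that the strip coordinate `2 θ` of the origin lies inside the strip. -/
theorem theta_lt : θ < π / 6 := by
  have := h.eq; have := h.lt; have := h.one_lt; have := h.mul_pi; have := Real.pi_pos
  by_contra hc
  push Not at hc
  nlinarith

/-- The strip is mapped outside the lens by `x ↦ -cot (a x)`, with `x = 0` going to infinity. On
this edge the cotangent is imaginary, which is the chord; the left edge goes to the arc. -/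
theorem mul_edge : a * (π / 4 + θ / 2) = π / 2 := by
  have := h.eq; have := h.mul_pi; linarith

theorem mul_edge' : a * (-(π / 4) + θ / 2) = -(π / 2) + β / 2 := by
  have := h.eq; have := h.mul_pi; linarith

end LensParams

open Complex Set Filter in
/-- A holomorphic function of moderate growth on a vertical strip of width `π / 2` with
nonnegative real part on the boundary has nonnegative real part. -/
theorem re_nonneg_of_verticalStrip {l r : ℝ} (hlr : r - l = π / 2) {F : ℂ → ℂ}
    (hF : ∀ z : ℂ, z.re ∈ Icc l r → DifferentiableAt ℂ F z) {c B : ℝ} (hc : c < 2)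
    (hB : ∀ z : ℂ, z.re ∈ Icc l r → 1 ≤ |z.im| → ‖F z‖ ≤ B * Real.exp (c * |z.im|))
    (hl : ∀ z : ℂ, z.re = l → 0 ≤ (F z).re) (hr : ∀ z : ℂ, z.re = r → 0 ≤ (F z).re)
    {z : ℂ} (hz : z.re ∈ Icc l r) : 0 ≤ (F z).re := by
  have hlt : l < r := by linarith [Real.pi_pos]
  have hn : ∀ z, ‖Complex.exp (-F z)‖ ≤ 1 ↔ 0 ≤ (F z).re := fun z => by
    -- The maximum principle is applied to `exp (-F)`; a strip of width `π / 2` admits growth `exp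
    -- (B exp (c |y|))` exactly for `c < 2`.
    rw [Complex.norm_exp, Real.exp_le_one_iff, Complex.neg_re]
    constructor <;> intro <;> linarith
  rw [← hn]
  refine PhragmenLindelof.vertical_strip (f := fun z => Complex.exp (-F z)) (a := l) (b := r) ?_
    ⟨c, ?_, B, ?_⟩ (fun z hz => (hn z).2 (hl z hz)) (fun z hz => (hn z).2 (hr z hz)) hz.1 hz.2
  · refine DifferentiableOn.diffContOnCl fun z hz => ?_
    rw [Complex.closure_preimage_re, closure_Ioo hlt.ne] at hz
    exact (hF z hz).neg.cexp.differentiableWithinAt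
  · rw [hlr]
    have : π / (π / 2) = 2 := by field_simp
    rwa [this]
  · refine Asymptotics.IsBigO.of_bound 1 ?_
    refine eventually_inf_principal.2 ?_
    refine (tendsto_comap.eventually (eventually_ge_atTop (1 : ℝ))).mono fun z hz hz' => ?_
    rw [one_mul, Complex.norm_exp, Real.norm_of_nonneg (Real.exp_pos _).le, Real.exp_le_exp]
    calc (-F z).re ≤ ‖-F z‖ := Complex.re_le_norm _
      _ = ‖F z‖ := norm_neg _
      _ ≤ _ := hB z (Ioo_subset_Icc_self hz') hz

/-! ### Positivity of the generating function on the lens. -/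

/-- The reciprocal, up to a positive factor, of the generating function of the Faber polynomials
of the lens; `c` is the position relative to the midpoint of the chord, `x` the coordinate in
a strip that is mapped conformally onto the exterior of the lens. -/
noncomputable def lensKernel (a θ : ℝ) (c x : ℂ) : ℂ :=
  sinRatio a x * (Complex.cos (a * x) + c * Complex.sin (a * x)) / Complex.cos (x - θ)

theorem lensKernel_of_ne_zero (a θ : ℝ) (c : ℂ) {x : ℂ} (hx : x ≠ 0) :
    lensKernel a θ c x = (Complex.sin (2 * (a * x)) + c * (1 - Complex.cos (2 * (a * x)))) /
      (Complex.sin (2 * x - θ) + Complex.sin θ) := by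
  have h1 : Complex.sin (2 * x - θ) + Complex.sin θ
      = 2 * (Complex.sin x * Complex.cos (x - θ)) := by
    obtain ⟨w, hw⟩ : ∃ w, w = x - (θ : ℂ) := ⟨_, rfl⟩
    have e1 : 2 * x - (θ : ℂ) = x + w := by rw [hw]; ring
    have e2 : (θ : ℂ) = x - w := by rw [hw]; ring
    rw [e1, ← hw, e2, Complex.sin_add, Complex.sin_sub]; ring
  have h2 : Complex.sin (2 * (a * x)) + c * (1 - Complex.cos (2 * (a * x))) =
      2 * (Complex.sin (a * x) * (Complex.cos (a * x) + c * Complex.sin (a * x))) := by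
    rw [Complex.sin_two_mul, Complex.cos_two_mul']
    linear_combination (-c) * Complex.sin_sq_add_cos_sq (a * x)
  rw [h1, h2, lensKernel, sinRatio_of_ne_zero a hx, mul_div_mul_left _ _ two_ne_zero,
    div_mul_eq_mul_div, div_div]

theorem norm_lensKernel_le {a θ : ℝ} (ha : 1 < a) (c : ℂ) {x : ℂ} (hx : 1 ≤ |x.im|) :
    ‖lensKernel a θ c x‖ ≤ 16 * (1 + ‖c‖) * Real.exp ((2 * a - 2) * |x.im|) := by
  have hx0 : x ≠ 0 := by rintro rfl; norm_num at hx
  set E := Real.exp |x.im| with hE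
  have hE0 : 0 < E := Real.exp_pos _
  have him : |((a : ℂ) * x).im| = a * |x.im| := by
    rw [Complex.im_ofReal_mul, abs_mul, abs_of_pos (by linarith)]
  have h1 := Complex.norm_sin_le_exp (a * x)
  have h2 := Complex.norm_cos_le_exp (a * x)
  rw [him] at h1 h2
  have h3 := Complex.exp_div_four_le_norm_sin hx
  have h4 : E / 4 ≤ ‖Complex.cos (x - θ)‖ := by
    have := Complex.exp_div_four_le_norm_cos (z := x - θ) (by simpa using hx)
    simpa using this
  set A := Real.exp (a * |x.im|) with hA
  have hA0 : 0 < A := Real.exp_pos _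
  have h5 : ‖Complex.cos (a * x) + c * Complex.sin (a * x)‖ ≤ (1 + ‖c‖) * A := by
    calc _ ≤ ‖Complex.cos (a * x)‖ + ‖c‖ * ‖Complex.sin (a * x)‖ := by
          rw [← norm_mul]; exact norm_add_le _ _
      _ ≤ A + ‖c‖ * A := by gcongr
      _ = _ := by ring
  have hAE : Real.exp ((2 * a - 2) * |x.im|) = A * A / (E * E) := by
    rw [hA, hE, ← Real.exp_add, ← Real.exp_add, ← Real.exp_sub]; congr 1; ring
  rw [lensKernel, sinRatio_of_ne_zero a hx0, norm_div, norm_mul, norm_div, hAE]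
  calc _ ≤ A / (E / 4) * ((1 + ‖c‖) * A) / (E / 4) := by gcongr
    _ = _ := by field_simp; norm_num

/-- Since `1 + cos q = 2 cos² (q / 2)`, the modulus is twice a squared modulus and needs no square
root. The exact value is needed for the sharp estimate on the arc edge. -/
theorem norm_one_add_cos (b w : ℝ) :
    ‖1 + Complex.cos (b + w * Complex.I)‖ = Real.cos b + Real.cosh w := by
  obtain ⟨p, rfl⟩ : ∃ p, b = 2 * p := ⟨b / 2, by ring⟩
  obtain ⟨q, rfl⟩ : ∃ q, w = 2 * q := ⟨w / 2, by ring⟩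
  have h1 : 1 + Complex.cos (((2 * p : ℝ) : ℂ) + ((2 * q : ℝ) : ℂ) * Complex.I)
      = 2 * Complex.cos (p + q * Complex.I) ^ 2 := by
    have : ((2 * p : ℝ) : ℂ) + ((2 * q : ℝ) : ℂ) * Complex.I = 2 * (p + q * Complex.I) := by
      push_cast; ring
    rw [this, Complex.cos_two_mul]; ring
  rw [h1, norm_mul, norm_pow, ← Complex.normSq_eq_norm_sq, Complex.cos_add_mul_I,
    ← Complex.ofReal_cos, ← Complex.ofReal_cosh, ← Complex.ofReal_sin, ← Complex.ofReal_sinh,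
    Complex.normSq_apply, Real.cos_two_mul, Real.cosh_two_mul]
  simp only [Complex.norm_ofNat, Complex.sub_re, Complex.sub_im, Complex.mul_re, Complex.mul_im,
    Complex.ofReal_re, Complex.ofReal_im, Complex.I_re, Complex.I_im]
  linear_combination (2 * Real.sinh q ^ 2) * Real.sin_sq_add_cos_sq p +
    (2 * Real.cos p ^ 2 - 1) * Real.cosh_sq q

namespace LensParams

variable {β a θ : ℝ}

theorem abs_re_lt (h : LensParams β a θ) {x : ℂ}
    (hx : x.re ∈ Set.Icc (-(π / 4) + θ / 2) (π / 4 + θ / 2)) : a * |x.re| < π := by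
  have h1 := h.mul_edge; have h2 := h.mul_edge'; have h3 := h.one_lt
  have h4 := h.lt; have h5 := h.pos
  have h6 : a * |x.re| = |a * x.re| := by
    rw [abs_mul, abs_of_pos (show 0 < a by linarith)]
  rw [h6, abs_lt]
  constructor <;> nlinarith [hx.1, hx.2]

theorem differentiableAt_lensKernel (h : LensParams β a θ) (c : ℂ) {x : ℂ}
    (hx : x.re ∈ Set.Icc (-(π / 4) + θ / 2) (π / 4 + θ / 2)) :
    DifferentiableAt ℂ (lensKernel a θ c) x := by
  have h1 := h.abs_re_lt hx
  have h2 := h.one_lt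
  have h3 := h.theta_pos
  have h4 := h.theta_lt
  have h5 : Complex.cos (x - θ) ≠ 0 := by
    refine Complex.cos_ne_zero_of_abs_re_lt ?_
    rw [Complex.sub_re, Complex.ofReal_re, abs_lt]
    constructor <;> linarith [hx.1, hx.2]
  have h6 := differentiableAt_sinRatio a (x := x) (by nlinarith [abs_nonneg x.re])
  unfold lensKernel
  exact (h6.mul (by fun_prop)).div (by fun_prop) h5

/-- The exterior map is starlike about every point of the convex lens. Each edge uses one of the two
conditions that define the lens: the disc condition serves on the arc edge, the half plane condition
on the chord edge. The growth exponent `2 a - 2` is admissible because `a < 2`. -/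
theorem lensKernel_re_nonneg (h : LensParams β a θ) {c : ℂ} (hc : 0 ≤ c.re)
    (hc' : ‖Real.cos β + c * Real.sin β‖ ≤ 1) {x : ℂ}
    (hx : x.re ∈ Set.Icc (-(π / 4) + θ / 2) (π / 4 + θ / 2)) : 0 ≤ (lensKernel a θ c x).re := by
  have ha := h.one_lt
  have hθ := h.theta_pos
  have hθ' := h.theta_lt
  have hπ := Real.pi_pos
  have hsinθ : Real.sin θ < 1 := by
    rw [← Real.sin_pi_div_two]
    exact Real.sin_lt_sin_of_lt_of_le_pi_div_two (by linarith) le_rfl (by linarith)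
  have hsinθ0 : 0 < Real.sin θ := Real.sin_pos_of_pos_of_lt_pi hθ (by linarith)
  refine re_nonneg_of_verticalStrip (by ring) (fun z hz => h.differentiableAt_lensKernel c hz)
    (c := 2 * a - 2) (by linarith [h.lt_two]) (fun z _ hz => norm_lensKernel_le ha c hz) ?_ ?_ hx
  · intro z hz
    have hz0 : z ≠ 0 := by
      rintro rfl; rw [Complex.zero_re] at hz; linarith
    set η := 2 * z.im
    have e0 : z = ((-(π / 4) + θ / 2 : ℝ) : ℂ) + ((η / 2 : ℝ) : ℂ) * Complex.I := by
      rw [← hz, show η / 2 = z.im by simp [η]]; exact (Complex.re_add_im z).symm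
    have e1 : 2 * ((a : ℂ) * z) = ((β : ℝ) + (a * η : ℝ) * Complex.I) - (π : ℝ) := by
      have : ((2 * (a * (-(π / 4) + θ / 2)) : ℝ) : ℂ) = ((-π + β : ℝ) : ℂ) := by
        rw [h.mul_edge']; congr 1; ring
      rw [e0]; push_cast at this ⊢; linear_combination this
    have e2 : 2 * z - (θ : ℂ) = (η : ℝ) * Complex.I - ((π : ℝ) : ℂ) / 2 := by
      rw [e0]; push_cast; ring
    rw [lensKernel_of_ne_zero a θ c hz0, e1, e2, Complex.sin_sub_pi, Complex.cos_sub_pi,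
      Complex.sin_sub_pi_div_two, Complex.cos_mul_I (η : ℂ), ← Complex.ofReal_cosh, ← Complex.ofReal_neg,
      ← Complex.ofReal_sin, ← Complex.ofReal_add, Complex.div_ofReal_re]
    refine div_nonneg_of_nonpos ?_ (by linarith [Real.one_le_cosh η])
    have hs : 0 < Real.sin β := Real.sin_pos_of_pos_of_lt_pi h.pos (by linarith [h.lt])
    set t : ℂ := Real.cos β + c * Real.sin β with ht
    set q : ℂ := β + (a * η : ℝ) * Complex.I with hq
    -- Multiplication by `sin β > 0` exchanges `c` for the point `t` of the closed unit disc, and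
    -- `re (t (1 + cos q)) ≤ |1 + cos q|` is all that is needed.
    have h1 : Real.sin β * (-Complex.sin q + c * (1 - -Complex.cos q))
        = t * (1 + Complex.cos q) - ((Real.cosh (a * η) + Real.cos β : ℝ) : ℂ) := by
      have h2 : Complex.cos ((a * η : ℝ) * Complex.I) = Complex.cos (q - β) := by
        congr 1; rw [hq]; ring
      rw [Complex.ofReal_add, Complex.ofReal_cosh, ← Complex.cos_mul_I, h2, Complex.cos_sub, ht,
        ← Complex.ofReal_cos, ← Complex.ofReal_sin]
      ring
    have h3 : (t * (1 + Complex.cos q)).re ≤ Real.cos β + Real.cosh (a * η) := by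
      calc _ ≤ ‖t * (1 + Complex.cos q)‖ := Complex.re_le_norm _
        _ ≤ 1 * ‖1 + Complex.cos q‖ := by rw [norm_mul]; gcongr
        _ = _ := by rw [one_mul, hq, norm_one_add_cos]
    have h4 := congrArg Complex.re h1
    rw [Complex.re_ofReal_mul, Complex.sub_re, Complex.ofReal_re] at h4
    by_contra hcon
    push Not at hcon
    have := mul_pos hs hcon
    linarith
  · intro z hz
    have hz0 : z ≠ 0 := by
      rintro rfl; rw [Complex.zero_re] at hz; linarith
    set η := 2 * z.im
    have e0 : z = ((π / 4 + θ / 2 : ℝ) : ℂ) + ((η / 2 : ℝ) : ℂ) * Complex.I := by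
      rw [← hz, show η / 2 = z.im by simp [η]]; exact (Complex.re_add_im z).symm
    have e1 : 2 * ((a : ℂ) * z) = (a * η : ℝ) * Complex.I + (π : ℝ) := by
      have : ((2 * (a * (π / 4 + θ / 2)) : ℝ) : ℂ) = ((π : ℝ) : ℂ) := by
        rw [h.mul_edge]; congr 1; ring
      rw [e0]; push_cast at this ⊢; linear_combination this
    have e2 : 2 * z - (θ : ℂ) = (η : ℝ) * Complex.I + ((π : ℝ) : ℂ) / 2 := by
      rw [e0]; push_cast; ring
    rw [lensKernel_of_ne_zero a θ c hz0, e1, e2, Complex.sin_add_pi, Complex.cos_add_pi,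
      Complex.sin_add_pi_div_two, Complex.cos_mul_I (η : ℂ), ← Complex.ofReal_cosh,
      ← Complex.ofReal_sin, ← Complex.ofReal_add, Complex.div_ofReal_re]
    refine div_nonneg ?_ (by linarith [Real.one_le_cosh η])
    rw [Complex.cos_mul_I, Complex.sin_mul_I, ← Complex.ofReal_cosh, ← Complex.ofReal_sinh]
    simp only [Complex.add_re, Complex.neg_re, Complex.mul_re, Complex.sub_re, Complex.sub_im,
      Complex.neg_im, Complex.ofReal_re, Complex.ofReal_im, Complex.I_re, Complex.I_im,
      Complex.one_re, Complex.one_im]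
    nlinarith [mul_nonneg hc (by linarith [Real.one_le_cosh (a * η)] : 0 ≤ 1 + cosh (a * η))]

end LensParams

/-! ### Real inequalities for the cotangent. -/

theorem monotoneOn_Icc_of_hasDerivAt_nonneg {f f' : ℝ → ℝ} {b : ℝ}
    (hf : ∀ x, HasDerivAt f (f' x) x) (h : ∀ x ∈ Set.Ioo 0 b, 0 ≤ f' x) :
    MonotoneOn f (Set.Icc 0 b) := by
  refine monotoneOn_of_deriv_nonneg (convex_Icc _ _)
    (fun x _ => (hf x).continuousAt.continuousWithinAt)
    (fun x _ => (hf x).differentiableAt.differentiableWithinAt) fun x hx => ?_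
  rw [interior_Icc] at hx
  rw [(hf x).deriv]
  exact h x hx

theorem mul_sinh_le_sinh_mul {a t : ℝ} (ha : 1 ≤ a) (ht : 0 ≤ t) :
    a * Real.sinh t ≤ Real.sinh (a * t) := by
  have hm := monotoneOn_Icc_of_hasDerivAt_nonneg (b := t)
    (f := fun t => Real.sinh (a * t) - a * Real.sinh t)
    (f' := fun t => Real.cosh (a * t) * a - a * Real.cosh t)
    (fun x => by
      have := (((hasDerivAt_id x).const_mul a).sinh).fun_sub ((Real.hasDerivAt_sinh x).const_mul a)
      simpa using this)
    (fun x hx => by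
      have : Real.cosh x ≤ Real.cosh (a * x) := by
        rw [Real.cosh_le_cosh, abs_mul, abs_of_pos (show 0 < a by linarith)]
        exact le_mul_of_one_le_left (abs_nonneg x) ha
      nlinarith)
  have := hm ⟨le_rfl, ht⟩ ⟨ht, le_rfl⟩ ht
  simp at this
  linarith

theorem sin_mul_le_mul_sin {a l : ℝ} (ha : 1 ≤ a) (hl : 0 ≤ l) (hal : a * l ≤ π) :
    Real.sin (a * l) ≤ a * Real.sin l := by
  have hm := monotoneOn_Icc_of_hasDerivAt_nonneg (b := l)
    (f := fun t => a * Real.sin t - Real.sin (a * t))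
    (f' := fun t => a * Real.cos t - Real.cos (a * t) * a)
    (fun x => by
      have := ((Real.hasDerivAt_sin x).const_mul a).fun_sub (((hasDerivAt_id x).const_mul a).sin)
      simpa using this)
    (fun x hx => by
      have : Real.cos (a * x) ≤ Real.cos x := by
        refine Real.cos_le_cos_of_nonneg_of_le_pi hx.1.le ?_ ?_
        · nlinarith [hx.2]
        · nlinarith [hx.1]
      nlinarith)
  have := hm ⟨le_rfl, hl⟩ ⟨hl, le_rfl⟩ hl
  simp at this
  linarith

/-- This is `a cot (a p) ≤ cot p` without denominators; the difference of the two sides has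
derivative `(a² - 1) sin (a p) sin p`. -/
theorem mul_cos_mul_sin_le {a p : ℝ} (ha : 1 ≤ a) (hp : 0 ≤ p) (hap : a * p ≤ π) :
    a * Real.cos (a * p) * Real.sin p ≤ Real.cos p * Real.sin (a * p) := by
  have hm := monotoneOn_Icc_of_hasDerivAt_nonneg (b := p)
    (f := fun t => Real.cos t * Real.sin (a * t) - a * Real.cos (a * t) * Real.sin t)
    (f' := fun t => (a ^ 2 - 1) * (Real.sin (a * t) * Real.sin t))
    (fun x => by
      have h1 : HasDerivAt (fun t => Real.sin (a * t)) (Real.cos (a * x) * a) x := by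
        simpa using ((hasDerivAt_id x).const_mul a).sin
      have h2 : HasDerivAt (fun t => Real.cos (a * t)) (-Real.sin (a * x) * a) x := by
        simpa using ((hasDerivAt_id x).const_mul a).cos
      have := ((Real.hasDerivAt_cos x).mul h1).sub ((h2.const_mul a).mul (Real.hasDerivAt_sin x))
      refine this.congr_deriv ?_
      ring)
    (fun x hx => by
      have h1 : 0 ≤ Real.sin x :=
        Real.sin_nonneg_of_nonneg_of_le_pi hx.1.le (by nlinarith [hx.1, hx.2])
      have h2 : 0 ≤ Real.sin (a * x) :=
        Real.sin_nonneg_of_nonneg_of_le_pi (by nlinarith [hx.1]) (by nlinarith [hx.1, hx.2])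
      exact mul_nonneg (by nlinarith) (mul_nonneg h2 h1))
  have := hm ⟨le_rfl, hp⟩ ⟨hp, le_rfl⟩ hp
  simp at this
  linarith

/-- `a re (cot (a z)) ≤ re (cot z)`, for `2 z = l + i η`. -/
theorem mul_re_cot_mul_le {a l η : ℝ} (ha : 1 ≤ a) (hl : 0 < l) (hal : a * l ≤ π) :
    a * (Real.sin (a * l) / (Real.cosh (a * η) - Real.cos (a * l))) ≤
      Real.sin l / (Real.cosh η - Real.cos l) := by
  have hπ := Real.pi_pos
  have hl2 : l ≤ π := by nlinarith
  have hcos : ∀ t, 0 < t → t ≤ π → Real.cos t < 1 := fun t h0 h1 => by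
    rw [← Real.cos_zero]; exact Real.cos_lt_cos_of_nonneg_of_le_pi le_rfl h1 h0
  have hc1 := hcos l hl hl2
  have hc2 := hcos (a * l) (by nlinarith) hal
  have hs1 : 0 ≤ Real.sin l := Real.sin_nonneg_of_nonneg_of_le_pi hl.le hl2
  have hs2 : 0 ≤ Real.sin (a * l) :=
    Real.sin_nonneg_of_nonneg_of_le_pi (by nlinarith) hal
  have hch1 := Real.one_le_cosh η
  rw [← mul_div_assoc, div_le_div_iff₀ (by linarith [Real.one_le_cosh (a * η)]) (by linarith)]
  -- Write `cosh η - cos l = (cosh η - 1) + (1 - cos l)`, and likewise with `a`. The two parts are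
  -- compared separately, here and in `h4`.
  have h1 : a * Real.sin (a * l) * (1 - Real.cos l) ≤ Real.sin l * (1 - Real.cos (a * l)) := by
    obtain ⟨p, rfl⟩ : ∃ p, l = 2 * p := ⟨l / 2, by ring⟩
    have h0 := mul_cos_mul_sin_le (p := p) ha (by linarith) (by nlinarith)
    have e : a * (2 * p) = 2 * (a * p) := by ring
    have hp1 : 0 ≤ Real.sin p := Real.sin_nonneg_of_nonneg_of_le_pi (by linarith) (by nlinarith)
    have hp2 : 0 ≤ Real.sin (a * p) :=
      Real.sin_nonneg_of_nonneg_of_le_pi (by nlinarith) (by nlinarith)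
    rw [e, Real.sin_two_mul, Real.sin_two_mul, Real.cos_two_mul', Real.cos_two_mul']
    have e1 : 1 - (Real.cos p ^ 2 - Real.sin p ^ 2) = 2 * Real.sin p ^ 2 := by
      linear_combination -Real.sin_sq_add_cos_sq p
    have e2 : 1 - (Real.cos (a * p) ^ 2 - Real.sin (a * p) ^ 2) = 2 * Real.sin (a * p) ^ 2 := by
      linear_combination -Real.sin_sq_add_cos_sq (a * p)
    rw [e1, e2]
    nlinarith [mul_le_mul_of_nonneg_left h0 (mul_nonneg hp1 hp2)]
  have h2 : a ^ 2 * (Real.cosh η - 1) ≤ Real.cosh (a * η) - 1 := by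
    rw [← Real.cosh_abs η, ← Real.cosh_abs (a * η), abs_mul, abs_of_pos (show 0 < a by linarith)]
    obtain ⟨t, ht⟩ : ∃ t, |η| = 2 * t := ⟨|η| / 2, by ring⟩
    have ht0 : 0 ≤ t := by linarith [abs_nonneg η]
    have e : a * (2 * t) = 2 * (a * t) := by ring
    have h0 := mul_sinh_le_sinh_mul ha ht0
    have hs : 0 ≤ Real.sinh t := Real.sinh_nonneg_iff.2 ht0
    rw [ht, e, Real.cosh_two_mul, Real.cosh_two_mul, Real.cosh_sq, Real.cosh_sq]
    have := pow_le_pow_left₀ (by positivity) h0 2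
    nlinarith
  have h3 := sin_mul_le_mul_sin ha hl.le hal
  have h4 : a * Real.sin (a * l) * (Real.cosh η - 1) ≤ Real.sin l * (Real.cosh (a * η) - 1) := by
    calc _ ≤ a * (a * Real.sin l) * (Real.cosh η - 1) := by gcongr
      _ = Real.sin l * (a ^ 2 * (Real.cosh η - 1)) := by ring
      _ ≤ _ := by gcongr
  linarith

/-! ### Positivity of the remainder at the origin. -/

/-- The analytic part of the generating function of the Faber polynomials of the lens at the
origin, whose pole has been removed. -/
noncomputable def faberRemainder (a θ : ℝ) (x : ℂ) : ℂ :=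
  1 / 2 - Complex.sin x * Complex.cos (x - θ) / Real.cos θ *
    (logDeriv (sinRatio a) (x - ((2 * θ : ℝ) : ℂ)) - logDeriv (sinRatio a) x)

/-- On both edges of the strip `2 x - θ` is `∓π / 2` plus an imaginary number, so in this form the
product is visibly real there. -/
theorem sin_mul_cos_sub (x θ : ℂ) :
    Complex.sin x * Complex.cos (x - θ) = (Complex.sin (2 * x - θ) + Complex.sin θ) / 2 := by
  obtain ⟨w, hw⟩ : ∃ w, w = x - θ := ⟨_, rfl⟩
  have e1 : 2 * x - θ = x + w := by rw [hw]; ring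
  have e2 : θ = x - w := by rw [hw]; ring
  rw [e1, ← hw, e2, Complex.sin_add, Complex.sin_sub]; ring

theorem cot_sub_cot {A B : ℂ} (hA : Complex.sin A ≠ 0) (hB : Complex.sin B ≠ 0) :
    Complex.cos A / Complex.sin A - Complex.cos B / Complex.sin B =
      Complex.sin (B - A) / (Complex.sin A * Complex.sin B) := by
  rw [div_sub_div _ _ hA hB, Complex.sin_sub]; ring

/-- The constant limits of the cotangent cancel, and the decay that remains balances the growth of
`sin x cos (x - θ)` in the remainder. -/
theorem norm_cot_sub_cot_le {A : ℂ} {r : ℝ} (hA : 1 ≤ |A.im|) :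
    ‖Complex.cos (A - r) / Complex.sin (A - r) - Complex.cos A / Complex.sin A‖
      ≤ 16 / (Real.exp |A.im| * Real.exp |A.im|) := by
  have h1 := Complex.exp_div_four_le_norm_sin hA
  have h2 : Real.exp |A.im| / 4 ≤ ‖Complex.sin (A - r)‖ := by
    have := Complex.exp_div_four_le_norm_sin (z := A - r) (by simpa using hA)
    simpa using this
  have hE := Real.exp_pos |A.im|
  have h3 : Complex.sin A ≠ 0 := norm_pos_iff.1 (by linarith)
  have h4 : Complex.sin (A - r) ≠ 0 := norm_pos_iff.1 (by linarith)
  rw [cot_sub_cot h4 h3, sub_sub_cancel, norm_div, norm_mul, ← Complex.ofReal_sin,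
    Complex.norm_real]
  calc _ ≤ 1 / (Real.exp |A.im| / 4 * (Real.exp |A.im| / 4)) := by
        gcongr; exact Real.abs_sin_le_one r
    _ = _ := by field_simp; norm_num

theorem re_logDeriv_sinRatio {a : ℝ} (ha : 1 ≤ a) {x : ℂ} (h0 : x ≠ 0) (hx : a * |x.re| < π) :
    (logDeriv (sinRatio a) x).re =
      a * (Real.sin (a * (2 * x.re)) /
        (Real.cosh (a * (2 * x.im)) - Real.cos (a * (2 * x.re)))) -
      Real.sin (2 * x.re) / (Real.cosh (2 * x.im) - Real.cos (2 * x.re)) := by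
  rw [logDeriv_sinRatio ha h0 hx, Complex.sub_re, Complex.re_ofReal_mul, Complex.re_cos_div_sin,
    Complex.re_cos_div_sin, Complex.re_ofReal_mul, Complex.im_ofReal_mul]
  simp only [mul_left_comm 2 a]

namespace LensParams

variable {β a θ : ℝ}

theorem abs_re_sub_lt (h : LensParams β a θ) {x : ℂ}
    (hx : x.re ∈ Set.Icc (-(π / 4) + θ / 2) (π / 4 + θ / 2)) :
    a * |(x - ((2 * θ : ℝ) : ℂ)).re| < π := by
  have h1 := h.mul_edge; have h2 := h.mul_edge'; have h3 := h.one_lt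
  have h4 := h.lt; have h5 := h.pos; have h7 := h.eq
  have h6 : ∀ t : ℝ, a * |t| = |a * t| := fun t => by
    rw [abs_mul, abs_of_pos (show 0 < a by linarith)]
  rw [h6, abs_lt, Complex.sub_re, Complex.ofReal_re]
  constructor <;> nlinarith [hx.1, hx.2]

theorem cos_theta_pos (h : LensParams β a θ) : 0 < Real.cos θ :=
  Real.cos_pos_of_mem_Ioo ⟨by linarith [h.theta_pos, Real.pi_pos],
    by linarith [h.theta_lt, Real.pi_pos]⟩

theorem differentiableAt_faberRemainder (h : LensParams β a θ) {x : ℂ}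
    (hx : x.re ∈ Set.Icc (-(π / 4) + θ / 2) (π / 4 + θ / 2)) :
    DifferentiableAt ℂ (faberRemainder a θ) x := by
  have h1 := differentiableAt_logDeriv_sinRatio h.one_lt.le (h.abs_re_lt hx)
  have h2 := differentiableAt_logDeriv_sinRatio h.one_lt.le (h.abs_re_sub_lt hx)
  have h3 : DifferentiableAt ℂ
      (fun x : ℂ => logDeriv (sinRatio a) (x - ((2 * θ : ℝ) : ℂ))) x :=
    DifferentiableAt.comp (f := fun x : ℂ => x - ((2 * θ : ℝ) : ℂ)) x h2 (by fun_prop)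
  unfold faberRemainder
  exact (differentiableAt_const _).sub
    (DifferentiableAt.mul (by fun_prop) (h3.sub h1))

theorem norm_faberRemainder_le (h : LensParams β a θ) {x : ℂ}
    (hx : x.re ∈ Set.Icc (-(π / 4) + θ / 2) (π / 4 + θ / 2)) (hi : 1 ≤ |x.im|) :
    ‖faberRemainder a θ x‖ ≤ 1 / 2 + 16 * (a + 1) / Real.cos θ := by
  have ha := h.one_lt
  have hc := h.cos_theta_pos
  have hx0 : x ≠ 0 := by rintro rfl; norm_num at hi
  have hx1 : x - ((2 * θ : ℝ) : ℂ) ≠ 0 := by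
    intro h0
    have := congrArg Complex.im h0
    simp at this
    rw [this] at hi; norm_num at hi
  have him : |((a : ℂ) * x).im| = a * |x.im| := by
    rw [Complex.im_ofReal_mul, abs_mul, abs_of_pos (show 0 < a by linarith)]
  have h1 := norm_cot_sub_cot_le (A := x) (r := 2 * θ) hi
  have h2 := norm_cot_sub_cot_le (A := a * x) (r := a * (2 * θ)) (by rw [him]; nlinarith)
  set E := Real.exp |x.im| with hE
  have hE0 : 0 < E := Real.exp_pos _
  have hEE : E ≤ Real.exp |((a : ℂ) * x).im| := by
    rw [him]; exact Real.exp_le_exp.2 (by nlinarith)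
  have h3 : ‖logDeriv (sinRatio a) (x - ((2 * θ : ℝ) : ℂ)) - logDeriv (sinRatio a) x‖
      ≤ 16 * (a + 1) / (E * E) := by
    rw [logDeriv_sinRatio ha.le hx1 (h.abs_re_sub_lt hx),
      logDeriv_sinRatio ha.le hx0 (h.abs_re_lt hx)]
    have e1 : (a : ℂ) * (x - ((2 * θ : ℝ) : ℂ)) = a * x - ((a * (2 * θ) : ℝ) : ℂ) := by
      push_cast; ring
    rw [e1, sub_sub_sub_comm, ← mul_sub]
    calc _ ≤ a * (16 / (E * E)) + 16 / (E * E) := by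
          refine (norm_sub_le _ _).trans (add_le_add ?_ h1)
          rw [norm_mul, Complex.norm_real, Real.norm_of_nonneg (by linarith)]
          refine mul_le_mul_of_nonneg_left (h2.trans ?_) (by linarith)
          gcongr
      _ = _ := by ring
  have h4 : ‖Complex.cos (x - θ)‖ ≤ E := by
    have := Complex.norm_cos_le_exp (x - θ)
    simpa using this
  have h5 : ‖Complex.sin x‖ ≤ E := Complex.norm_sin_le_exp x
  unfold faberRemainder
  refine (norm_sub_le _ _).trans (add_le_add (by norm_num) ?_)
  rw [norm_mul, norm_div, norm_mul, Complex.norm_real, Real.norm_of_nonneg hc.le]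
  calc _ ≤ E * E / Real.cos θ * (16 * (a + 1) / (E * E)) := by gcongr
    _ = _ := by field_simp

/-- On either edge the term from `cot x` cancels the constant `1 / 2`. What is left is a sum of
nonnegative terms on the left edge; on the right edge `re (cot (a x))` vanishes and the sign comes
from `mul_re_cot_mul_le` at `l = π / 2 - 3 θ`. -/
theorem faberRemainder_re_nonneg (h : LensParams β a θ) {x : ℂ}
    (hx : x.re ∈ Set.Icc (-(π / 4) + θ / 2) (π / 4 + θ / 2)) :
    0 ≤ (faberRemainder a θ x).re := by
  have ha := h.one_lt
  have hθ := h.theta_pos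
  have hθ' := h.theta_lt
  have hπ := Real.pi_pos
  have hcθ := h.cos_theta_pos
  have hβ := h.lt
  have hβ0 := h.pos
  have haπ := h.mul_pi
  have heq := h.eq
  have hsβ : 0 < Real.sin β := Real.sin_pos_of_pos_of_lt_pi hβ0 (by linarith)
  have hcβ : 0 < Real.cos β := Real.cos_pos_of_mem_Ioo ⟨by linarith, hβ⟩
  have hsinθ : Real.sin θ < 1 := by
    rw [← Real.sin_pi_div_two]
    exact Real.sin_lt_sin_of_lt_of_le_pi_div_two (by linarith) le_rfl (by linarith)
  have hsinθ0 : 0 < Real.sin θ := Real.sin_pos_of_pos_of_lt_pi hθ (by linarith)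
  have hmem : ∀ z : ℂ, z.re = -(π / 4) + θ / 2 ∨ z.re = π / 4 + θ / 2 →
      z.re ∈ Set.Icc (-(π / 4) + θ / 2) (π / 4 + θ / 2) := by
    rintro z (hz | hz) <;> rw [hz] <;> constructor <;> linarith
  have hne : ∀ z : ℂ, z.re = -(π / 4) + θ / 2 ∨ z.re = π / 4 + θ / 2 →
      z ≠ 0 ∧ z - ((2 * θ : ℝ) : ℂ) ≠ 0 := by
    intro z hz
    constructor <;> intro h0 <;> have h1 := congrArg Complex.re h0 <;>
      simp only [Complex.sub_re, Complex.ofReal_re, Complex.zero_re] at h1 <;>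
      rcases hz with hz | hz <;> linarith
  have hre : ∀ (z : ℂ) (R : ℝ), Complex.sin (2 * z - θ) = R →
      (faberRemainder a θ z).re = 1 / 2 - (R + Real.sin θ) / 2 / Real.cos θ *
        ((logDeriv (sinRatio a) (z - ((2 * θ : ℝ) : ℂ))).re -
          (logDeriv (sinRatio a) z).re) := by
    intro z R hR
    have : Complex.sin z * Complex.cos (z - θ) / Real.cos θ
        = (((R + Real.sin θ) / 2 / Real.cos θ : ℝ) : ℂ) := by
      rw [sin_mul_cos_sub, hR, ← Complex.ofReal_sin]; push_cast; rfl
    rw [faberRemainder, this, Complex.sub_re, Complex.re_ofReal_mul, Complex.sub_re]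
    norm_num
  refine re_nonneg_of_verticalStrip (by ring) (fun z hz => h.differentiableAt_faberRemainder hz)
    (c := 0) (B := 1 / 2 + 16 * (a + 1) / Real.cos θ) (by norm_num)
    (fun z hz hi => by simpa using h.norm_faberRemainder_le hz hi) ?_ ?_ hx
  · intro z hz
    obtain ⟨hz0, hz1⟩ := hne z (.inl hz)
    set η := 2 * z.im with hη
    have hR : Complex.sin (2 * z - θ) = ((-Real.cosh η : ℝ) : ℂ) := by
      have e0 : z = ((-(π / 4) + θ / 2 : ℝ) : ℂ) + ((η / 2 : ℝ) : ℂ) * Complex.I := by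
        rw [← hz, show η / 2 = z.im by simp [η]]; exact (Complex.re_add_im z).symm
      have e2 : 2 * z - (θ : ℂ) = (η : ℝ) * Complex.I - ((π : ℝ) : ℂ) / 2 := by
        rw [e0]; push_cast; ring
      rw [e2, Complex.sin_sub_pi_div_two, Complex.cos_mul_I, ← Complex.ofReal_cosh,
        Complex.ofReal_neg]
    have e1 : 2 * z.re = θ - π / 2 := by rw [hz]; ring
    have e2 : a * (2 * z.re) = β - π := by rw [hz]; linarith
    have e3 : 2 * (z - ((2 * θ : ℝ) : ℂ)).re = -(3 * θ) - π / 2 := by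
      rw [Complex.sub_re, Complex.ofReal_re, hz]; ring
    have e4 : a * (2 * (z - ((2 * θ : ℝ) : ℂ)).re) = -β - π := by
      rw [Complex.sub_re, Complex.ofReal_re, hz]; linarith
    have e5 : 2 * (z - ((2 * θ : ℝ) : ℂ)).im = η := by simp [hη]
    have hf1 := re_logDeriv_sinRatio ha.le hz0 (h.abs_re_lt (hmem z (.inl hz)))
    have hf2 := re_logDeriv_sinRatio ha.le hz1 (h.abs_re_sub_lt (hmem z (.inl hz)))
    rw [e2, e1, ← hη, Real.sin_sub_pi, Real.cos_sub_pi, Real.sin_sub_pi_div_two,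
      Real.cos_sub_pi_div_two] at hf1
    rw [e4, e3, e5, Real.sin_sub_pi, Real.cos_sub_pi, Real.sin_sub_pi_div_two,
      Real.cos_sub_pi_div_two, Real.sin_neg, Real.cos_neg, Real.sin_neg, Real.cos_neg] at hf2
    have hC := Real.one_le_cosh η
    have hCa := Real.one_le_cosh (a * η)
    have hs3 : 0 ≤ Real.sin (3 * θ) :=
      Real.sin_nonneg_of_nonneg_of_le_pi (by linarith) (by linarith)
    have hc3 : 0 ≤ Real.cos (3 * θ) :=
      Real.cos_nonneg_of_mem_Icc ⟨by linarith, by linarith⟩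
    rw [hre z _ hR, hf1, hf2]
    have hCs : Real.cosh η - Real.sin θ ≠ 0 := by linarith
    have e : 1 / 2 - (-Real.cosh η + Real.sin θ) / 2 / Real.cos θ *
        (a * (- -Real.sin β / (Real.cosh (a * η) - -Real.cos β)) -
          -Real.cos (3 * θ) / (Real.cosh η - -Real.sin (3 * θ)) -
        (a * (-Real.sin β / (Real.cosh (a * η) - -Real.cos β)) -
          -Real.cos θ / (Real.cosh η - Real.sin θ))) =
        (Real.cosh η - Real.sin θ) / 2 / Real.cos θ *
        (2 * (a * (Real.sin β / (Real.cosh (a * η) + Real.cos β))) +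
          Real.cos (3 * θ) / (Real.cosh η + Real.sin (3 * θ))) := by
      have : (Real.cosh η - Real.sin θ) / 2 / Real.cos θ *
          (Real.cos θ / (Real.cosh η - Real.sin θ)) = 1 / 2 := by field_simp
      rw [sub_neg_eq_add, sub_neg_eq_add]
      linear_combination -this
    rw [e]
    have : 0 ≤ Real.cosh η - Real.sin θ := by linarith
    positivity
  · intro z hz
    obtain ⟨hz0, hz1⟩ := hne z (.inr hz)
    set η := 2 * z.im with hη
    have hR : Complex.sin (2 * z - θ) = ((Real.cosh η : ℝ) : ℂ) := by
      have e0 : z = ((π / 4 + θ / 2 : ℝ) : ℂ) + ((η / 2 : ℝ) : ℂ) * Complex.I := by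
        rw [← hz, show η / 2 = z.im by simp [η]]; exact (Complex.re_add_im z).symm
      have e2 : 2 * z - (θ : ℂ) = (η : ℝ) * Complex.I + ((π : ℝ) : ℂ) / 2 := by
        rw [e0]; push_cast; ring
      rw [e2, Complex.sin_add_pi_div_two, Complex.cos_mul_I, ← Complex.ofReal_cosh]
    have e1 : 2 * z.re = θ + π / 2 := by rw [hz]; ring
    have e2 : a * (2 * z.re) = π := by rw [hz]; linarith
    have e3 : 2 * (z - ((2 * θ : ℝ) : ℂ)).re = π / 2 - 3 * θ := by
      rw [Complex.sub_re, Complex.ofReal_re, hz]; ring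
    have e5 : 2 * (z - ((2 * θ : ℝ) : ℂ)).im = η := by simp [hη]
    have hf1 := re_logDeriv_sinRatio ha.le hz0 (h.abs_re_lt (hmem z (.inr hz)))
    have hf2 := re_logDeriv_sinRatio ha.le hz1 (h.abs_re_sub_lt (hmem z (.inr hz)))
    rw [e2, e1, ← hη, Real.sin_pi, Real.sin_add_pi_div_two, Real.cos_add_pi_div_two] at hf1
    rw [e3, e5] at hf2
    have hkey := mul_re_cot_mul_le (a := a) (l := π / 2 - 3 * θ) (η := η) ha.le (by linarith)
      (by nlinarith)
    have hC := Real.one_le_cosh η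
    rw [hre z _ hR, hf1]
    have hCs : Real.cosh η + Real.sin θ ≠ 0 := by linarith
    have e : (Real.cosh η + Real.sin θ) / 2 / Real.cos θ *
          (Real.cos θ / (Real.cosh η + Real.sin θ)) = 1 / 2 := by field_simp
    have hf2' : (logDeriv (sinRatio a) (z - ((2 * θ : ℝ) : ℂ))).re ≤ 0 := by linarith
    have : 0 ≤ (Real.cosh η + Real.sin θ) / 2 / Real.cos θ *
        -(logDeriv (sinRatio a) (z - ((2 * θ : ℝ) : ℂ))).re :=
      mul_nonneg (by positivity) (by linarith)
    rw [zero_div, mul_zero, sub_neg_eq_add]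
    linarith

end LensParams

/-! ### The disc coordinate of the exterior of the lens. -/

theorem Complex.normSq_sin (z : ℂ) :
    Complex.normSq (Complex.sin z) = (Real.cosh (2 * z.im) - Real.cos (2 * z.re)) / 2 := by
  have h : Complex.sin z = Complex.sin z.re * Complex.cosh z.im +
      Complex.cos z.re * Complex.sinh z.im * Complex.I := by
    rw [← Complex.sin_add_mul_I, Complex.re_add_im]
  rw [h, ← Complex.ofReal_cos, ← Complex.ofReal_cosh, ← Complex.ofReal_sin, ← Complex.ofReal_sinh,
    Complex.normSq_apply, Real.cosh_two_mul, Real.cos_two_mul]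
  simp only [Complex.add_re, Complex.add_im, Complex.mul_re, Complex.mul_im,
    Complex.ofReal_re, Complex.ofReal_im, Complex.I_re, Complex.I_im]
  linear_combination Real.cosh z.im ^ 2 * Real.sin_sq_add_cos_sq z.re +
    (1 / 2 - Real.cos z.re ^ 2) * Real.cosh_sq z.im

/-- The holomorphic map of the unit disc onto the half plane, composed with a logarithm: the
strip coordinate of the point of the exterior of the lens belonging to `u`. -/
noncomputable def lensCoord (θ : ℝ) (u : ℂ) : ℂ :=
  (-Complex.I * Complex.log ((Complex.exp (-(θ * Complex.I)) + Complex.I * u) /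
    (1 - Complex.I * u * Complex.exp (-(θ * Complex.I)))) + θ) / 2

theorem norm_exp_neg_mul_I (θ : ℝ) : ‖Complex.exp (-(θ * Complex.I))‖ = 1 := by
  rw [← neg_mul, ← Complex.ofReal_neg]; exact Complex.norm_exp_ofReal_mul_I _

theorem one_sub_ne_zero_of_norm_lt {θ : ℝ} {u : ℂ} (hu : ‖u‖ < 1) :
    1 - Complex.I * u * Complex.exp (-(θ * Complex.I)) ≠ 0 := by
  intro h
  have h1 : ‖Complex.I * u * Complex.exp (-(θ * Complex.I))‖ = 1 := by
    rw [← sub_eq_zero.1 h, norm_one]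
  rw [norm_mul, norm_mul, norm_exp_neg_mul_I, Complex.norm_I] at h1
  linarith

/-- The numerator times the conjugate of the denominator has real part `cos θ (1 - |u|²)`. -/
theorem re_halfPlane_pos {θ : ℝ} (hθ : 0 < Real.cos θ) {u : ℂ} (hu : ‖u‖ < 1) :
    0 < ((Complex.exp (-(θ * Complex.I)) + Complex.I * u) /
      (1 - Complex.I * u * Complex.exp (-(θ * Complex.I)))).re := by
  have h0 := one_sub_ne_zero_of_norm_lt (θ := θ) hu
  have he : Complex.exp (-(θ * Complex.I)) = ⟨Real.cos θ, -Real.sin θ⟩ := by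
    rw [← neg_mul, ← Complex.ofReal_neg, Complex.exp_mul_I, ← Complex.ofReal_cos,
      ← Complex.ofReal_sin, Real.cos_neg, Real.sin_neg]
    simp only [Complex.ext_iff, Complex.add_re, Complex.add_im, Complex.mul_re, Complex.mul_im,
      Complex.ofReal_re, Complex.ofReal_im, Complex.I_re, Complex.I_im]
    constructor <;> ring
  have hu2 : u.re ^ 2 + u.im ^ 2 < 1 := by
    have := Complex.sq_norm u
    rw [Complex.normSq_apply] at this
    nlinarith [norm_nonneg u]
  rw [he] at h0 ⊢
  rw [Complex.div_re, ← add_div]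
  refine div_pos ?_ (Complex.normSq_pos.2 h0)
  simp only [Complex.add_re, Complex.add_im, Complex.mul_re, Complex.mul_im, Complex.sub_re,
    Complex.sub_im, Complex.one_re, Complex.one_im, Complex.I_re, Complex.I_im]
  have h1 := Real.sin_sq_add_cos_sq θ
  have h2 : 0 < Real.cos θ * (1 - u.re ^ 2 - u.im ^ 2) := mul_pos hθ (by linarith)
  have h3 : u.im * (Real.sin θ ^ 2 + Real.cos θ ^ 2) = u.im := by rw [h1, mul_one]
  linarith

theorem lensCoord_zero {θ : ℝ} (h0 : 0 < θ) (h1 : θ < π) : lensCoord θ 0 = 0 := by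
  have : Complex.log (Complex.exp (-(θ * Complex.I))) = -(θ * Complex.I) := by
    rw [Complex.log_exp] <;> simp <;> linarith
  simp only [lensCoord, mul_zero, zero_mul, add_zero, sub_zero, div_one, this]
  linear_combination (θ / 2 : ℂ) * Complex.I_mul_I

theorem lensCoord_re_mem {θ : ℝ} (hθ : 0 < Real.cos θ) {u : ℂ} (hu : ‖u‖ < 1) :
    (lensCoord θ u).re ∈ Set.Ioo (-(π / 4) + θ / 2) (π / 4 + θ / 2) := by
  have h1 := re_halfPlane_pos hθ hu
  have h2 := abs_lt.1 (Complex.abs_arg_lt_pi_div_two_iff.2 (Or.inl h1))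
  have h3 : (lensCoord θ u).re = (Complex.arg ((Complex.exp (-(θ * Complex.I)) + Complex.I * u) /
      (1 - Complex.I * u * Complex.exp (-(θ * Complex.I)))) + θ) / 2 := by
    simp [lensCoord, Complex.log_im]
  rw [h3]
  constructor <;> linarith [h2.1, h2.2]

theorem differentiableAt_lensCoord {θ : ℝ} (hθ : 0 < Real.cos θ) {u : ℂ} (hu : ‖u‖ < 1) :
    DifferentiableAt ℂ (lensCoord θ) u := by
  have h1 := re_halfPlane_pos hθ hu
  have h2 := one_sub_ne_zero_of_norm_lt (θ := θ) hu
  unfold lensCoord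
  generalize Complex.exp (-(θ * Complex.I)) = p at *
  have h3 : DifferentiableAt ℂ (fun u => (p + Complex.I * u) / (1 - Complex.I * u * p)) u :=
    DifferentiableAt.fun_div (by fun_prop) (by fun_prop) h2
  have h4 := h3.clog (Or.inl h1)
  exact ((h4.const_mul (-Complex.I)).add_const (θ : ℂ)).div_const 2

theorem exp_identity {E p u v : ℂ} (hE0 : E ≠ 0) (hp0 : p ≠ 0) (hx : E * E = v * p)
    (hv : v * (1 - Complex.I * u * p⁻¹) = p⁻¹ + Complex.I * u) :
    (E⁻¹ - E) * Complex.I / 2 = u * ((E * p⁻¹ + E⁻¹ * p) / 2) := by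
  have hpi : p * p⁻¹ = 1 := mul_inv_cancel₀ hp0
  have hEi : E * E⁻¹ = 1 := mul_inv_cancel₀ hE0
  have key : E * E - 1 = Complex.I * u * (E * E * p⁻¹ + p) := by
    rw [hx]
    linear_combination p * hv + hpi
  refine mul_left_cancel₀ hE0 ?_
  linear_combination (Complex.I / 2 - u * p / 2) * hEi - Complex.I / 2 * key -
      (u / 2 * (E * E * p⁻¹ + p)) * Complex.I_mul_I

theorem sin_eq_mul_cos_sub {x θ u v : ℂ}
    (hx : Complex.exp (x * Complex.I) * Complex.exp (x * Complex.I)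
      = v * Complex.exp (θ * Complex.I))
    (hv : v * (1 - Complex.I * u * Complex.exp (-(θ * Complex.I)))
      = Complex.exp (-(θ * Complex.I)) + Complex.I * u) :
    Complex.sin x = u * Complex.cos (x - θ) := by
  have e1 : Complex.exp (-x * Complex.I) = (Complex.exp (x * Complex.I))⁻¹ := by
    rw [neg_mul, Complex.exp_neg]
  have e2 : Complex.exp ((x - θ) * Complex.I)
      = Complex.exp (x * Complex.I) * (Complex.exp (θ * Complex.I))⁻¹ := by
    rw [sub_mul, Complex.exp_sub, div_eq_mul_inv]
  have e3 : Complex.exp (-(x - θ) * Complex.I)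
      = (Complex.exp (x * Complex.I))⁻¹ * Complex.exp (θ * Complex.I) := by
    rw [neg_mul, Complex.exp_neg, e2, mul_inv, inv_inv]
  have hp0 := Complex.exp_ne_zero (θ * Complex.I)
  have hE0 := Complex.exp_ne_zero (x * Complex.I)
  rw [Complex.exp_neg] at hv
  rw [Complex.sin, Complex.cos, e1, e2, e3]
  exact exp_identity hE0 hp0 hx hv

/-- The inverse of the coordinate is `u = sin x / cos (x - θ)`; at `x = 2 θ` it takes the value `2
sin θ`, which is the origin of the rate `γ`. -/
theorem sin_lensCoord {θ : ℝ} (hθ : 0 < Real.cos θ) {u : ℂ} (hu : ‖u‖ < 1) :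
    Complex.sin (lensCoord θ u) = u * Complex.cos (lensCoord θ u - θ) := by
  have h1 := re_halfPlane_pos hθ hu
  have h2 := one_sub_ne_zero_of_norm_lt (θ := θ) hu
  refine sin_eq_mul_cos_sub (v := (Complex.exp (-(θ * Complex.I)) + Complex.I * u) /
      (1 - Complex.I * u * Complex.exp (-(θ * Complex.I)))) ?_ (div_mul_cancel₀ _ h2)
  unfold lensCoord
  generalize (Complex.exp (-(θ * Complex.I)) + Complex.I * u) /
      (1 - Complex.I * u * Complex.exp (-(θ * Complex.I))) = v at *
  have hv0 : v ≠ 0 := by rintro rfl; simp at h1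
  rw [← Complex.exp_add]
  conv_rhs => rw [← Complex.exp_log hv0, ← Complex.exp_add]
  congr 1
  linear_combination (-Complex.log v) * Complex.I_mul_I

namespace LensParams

variable {β a θ : ℝ}

theorem re_mul_mem (h : LensParams β a θ) {x : ℂ}
    (hx : x.re ∈ Set.Ioo (-(π / 4) + θ / 2) (π / 4 + θ / 2)) :
    -π + β < 2 * ((a : ℂ) * x).re ∧ 2 * ((a : ℂ) * x).re < π := by
  have h1 := h.mul_edge; have h2 := h.mul_edge'; have h3 := h.one_lt
  rw [Complex.re_ofReal_mul]
  constructor <;> nlinarith [hx.1, hx.2]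

theorem cos_mul_ne_zero (h : LensParams β a θ) {x : ℂ}
    (hx : x.re ∈ Set.Ioo (-(π / 4) + θ / 2) (π / 4 + θ / 2)) : Complex.cos (a * x) ≠ 0 := by
  have h1 := h.re_mul_mem hx
  have h2 := h.pos
  exact Complex.cos_ne_zero_of_abs_re_lt (abs_lt.2 ⟨by linarith, by linarith⟩)

/-- A zero would put `-cot Y`, with `Y = a x`, in the lens. Then `0 ≤ re c` forces `re Y ≤ 0`, while
the disc condition says `|sin (Y - β)| ≤ |sin Y|`, that is `0 ≤ sin β sin (2 re Y - β)`. But `2 re Y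
- β` lies in `(-π, 0)`. -/
theorem cos_add_mul_sin_ne_zero (h : LensParams β a θ) {c : ℂ} (hc : 0 ≤ c.re)
    (hc' : ‖Real.cos β + c * Real.sin β‖ ≤ 1) {x : ℂ}
    (hx : x.re ∈ Set.Ioo (-(π / 4) + θ / 2) (π / 4 + θ / 2)) :
    Complex.cos (a * x) + c * Complex.sin (a * x) ≠ 0 := by
  intro h0
  obtain ⟨h1, h2⟩ := h.re_mul_mem hx
  have hβ := h.lt
  have hβ0 := h.pos
  set Y : ℂ := a * x with hY
  have hcos : Complex.cos Y ≠ 0 := h.cos_mul_ne_zero hx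
  have hsin : Complex.sin Y ≠ 0 := by
    intro hs; rw [hs, mul_zero, add_zero] at h0; exact hcos h0
  have hcot : Complex.cos Y / Complex.sin Y = -c := by
    rw [div_eq_iff hsin]; linear_combination h0
  have hre := Complex.re_cos_div_sin Y
  have hn := Complex.normSq_sin Y
  have hpos : 0 < Real.cosh (2 * Y.im) - Real.cos (2 * Y.re) := by
    have := Complex.normSq_pos.2 hsin; linarith
  have h3 : Real.sin (2 * Y.re) ≤ 0 := by
    rw [hcot, Complex.neg_re, eq_div_iff hpos.ne'] at hre
    nlinarith
  have h4 : 2 * Y.re ≤ 0 := by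
    by_contra hcon
    push Not at hcon
    have := Real.sin_pos_of_pos_of_lt_pi hcon h2
    linarith
  have h5 : Complex.normSq (Complex.sin (Y - β)) ≤ Complex.normSq (Complex.sin Y) := by
    have e : Complex.sin (Y - β) = (Real.cos β + c * Real.sin β) * Complex.sin Y := by
      rw [Complex.sin_sub, Complex.ofReal_cos, Complex.ofReal_sin]
      linear_combination (-Complex.sin β) * h0
    rw [Complex.normSq_eq_norm_sq, Complex.normSq_eq_norm_sq, e, norm_mul]
    gcongr
    exact mul_le_of_le_one_left (norm_nonneg _) hc'
  rw [hn, Complex.normSq_sin] at h5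
  obtain ⟨D, hD⟩ : ∃ D, D = 2 * Y.re - β := ⟨_, rfl⟩
  have e1 : (Y - β).im = Y.im := by simp
  have e2 : 2 * (Y - β).re = D - β := by simp [hD]; ring
  have e3 : 2 * Y.re = D + β := by rw [hD]; ring
  rw [e1, e2, e3, Real.cos_sub, Real.cos_add] at h5
  have h6 : Real.sin D < 0 := Real.sin_neg_of_neg_of_neg_pi_lt (by linarith) (by linarith)
  have h7 : 0 < Real.sin β := Real.sin_pos_of_pos_of_lt_pi hβ0 (by linarith)
  nlinarith [mul_pos h7 (neg_pos.2 h6)]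

end LensParams

/-! ### Faber polynomials of the lens. -/

/-- The scalar factor of the generating function of the Faber polynomials of the lens. -/
noncomputable def faberFactor (a θ : ℝ) (u : ℂ) : ℂ :=
  (a / Real.cos θ : ℝ) * (Complex.cos (lensCoord θ u - θ) / sinRatio a (lensCoord θ u))

/-- The coefficient functions of the generating function as a power series in the position. -/
noncomputable def faberCoeffFun (a θ : ℝ) (j : ℕ) (u : ℂ) : ℂ :=
  faberFactor a θ u * ((Complex.cos (a * lensCoord θ u))⁻¹ *
    (-(Complex.sin (a * lensCoord θ u) / Complex.cos (a * lensCoord θ u))) ^ j)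

open Polynomial in
/-- The `n`-th Faber polynomial of the lens, in the coordinate for which the chord has its midpoint
at the origin and half-length one. -/
noncomputable def lensFaber (a θ : ℝ) (n : ℕ) : ℂ[X] :=
  ∑ j ∈ Finset.range (n + 1), monomial j (iteratedDeriv n (faberCoeffFun a θ j) 0 / n.factorial)

theorem natDegree_lensFaber_le (a θ : ℝ) (n : ℕ) : (lensFaber a θ n).natDegree ≤ n := by
  refine Polynomial.natDegree_sum_le_of_forall_le _ _ fun j hj => ?_
  exact (Polynomial.natDegree_monomial_le _).trans (by simpa [Nat.lt_succ_iff] using hj)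

/-- A finite geometric series with ratio `-(z / y) S`. The algebra is arbitrary so that the same
expansion serves operators and evaluation at a point. -/
theorem geometric_expansion {R : Type*} [Ring R] [Algebra ℂ R] {S Q : R} {y z : ℂ} (hy : y ≠ 0)
    (h : (y • (1 : R) + z • S) * Q = 1) (n : ℕ) :
    Q = ∑ j ∈ Finset.range (n + 1), (y⁻¹ * (-(z / y)) ^ j) • S ^ j +
      (-(z / y)) ^ (n + 1) • (S ^ (n + 1) * Q) := by
  have h1 : (1 - (-(z / y)) • S) * Q = y⁻¹ • 1 := by
    have : (1 : R) - (-(z / y)) • S = y⁻¹ • (y • (1 : R) + z • S) := by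
      rw [smul_add, smul_smul, inv_mul_cancel₀ hy, one_smul, neg_smul, sub_neg_eq_add, smul_smul,
        div_eq_inv_mul]
    rw [this, smul_mul_assoc, h]
  have h2 := geom_sum_mul_neg ((-(z / y)) • S) (n + 1)
  have h3 : (∑ i ∈ Finset.range (n + 1), ((-(z / y)) • S) ^ i) * (y⁻¹ • (1 : R))
      = Q - ((-(z / y)) • S) ^ (n + 1) * Q := by
    rw [← h1, ← mul_assoc, h2, sub_mul, one_mul]
  rw [eq_sub_iff_add_eq] at h3
  conv_lhs => rw [← h3, smul_pow, smul_mul_assoc, Finset.sum_mul]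
  congr 1
  refine Finset.sum_congr rfl fun j _ => ?_
  rw [smul_pow, mul_smul_comm, mul_one, smul_smul]

namespace LensParams

variable {β a θ : ℝ}

theorem lensCoord_zero (h : LensParams β a θ) : lensCoord θ 0 = 0 :=
  _root_.lensCoord_zero h.theta_pos (by linarith [h.theta_lt, Real.pi_pos])

theorem cos_sub_theta_ne_zero (h : LensParams β a θ) {u : ℂ} (hu : ‖u‖ < 1) :
    Complex.cos (lensCoord θ u - θ) ≠ 0 := by
  have hx := lensCoord_re_mem h.cos_theta_pos hu
  refine Complex.cos_ne_zero_of_abs_re_lt ?_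
  rw [Complex.sub_re, Complex.ofReal_re, abs_lt]
  constructor <;> linarith [hx.1, hx.2, h.theta_pos, h.theta_lt]

theorem sinRatio_lensCoord_ne_zero (h : LensParams β a θ) {u : ℂ} (hu : ‖u‖ < 1) :
    sinRatio a (lensCoord θ u) ≠ 0 :=
  sinRatio_ne_zero h.one_lt.le
    (h.abs_re_lt (Set.Ioo_subset_Icc_self (lensCoord_re_mem h.cos_theta_pos hu)))

theorem differentiableAt_faberFactor (h : LensParams β a θ) {u : ℂ} (hu : ‖u‖ < 1) :
    DifferentiableAt ℂ (faberFactor a θ) u := by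
  have h1 := differentiableAt_lensCoord h.cos_theta_pos hu
  have h2 : DifferentiableAt ℂ (sinRatio a) (lensCoord θ u) :=
    differentiableAt_sinRatio a (by
      have := h.abs_re_lt (Set.Ioo_subset_Icc_self (lensCoord_re_mem h.cos_theta_pos hu))
      nlinarith [abs_nonneg (lensCoord θ u).re, h.one_lt])
  exact ((h1.sub_const (θ : ℂ)).ccos.fun_div (h2.comp u h1)
    (h.sinRatio_lensCoord_ne_zero hu)).const_mul _

theorem differentiableAt_sin_div_cos (h : LensParams β a θ) {u : ℂ} (hu : ‖u‖ < 1) :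
    DifferentiableAt ℂ
      (fun u => Complex.sin (a * lensCoord θ u) / Complex.cos (a * lensCoord θ u)) u := by
  have h1 := (differentiableAt_lensCoord h.cos_theta_pos hu).const_mul (a : ℂ)
  exact h1.csin.fun_div h1.ccos (h.cos_mul_ne_zero (lensCoord_re_mem h.cos_theta_pos hu))

theorem differentiableAt_faberCoeffFun (h : LensParams β a θ) (j : ℕ) {u : ℂ} (hu : ‖u‖ < 1) :
    DifferentiableAt ℂ (faberCoeffFun a θ j) u := by
  have h1 := (differentiableAt_lensCoord h.cos_theta_pos hu).const_mul (a : ℂ)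
  have h2 := h.cos_mul_ne_zero (lensCoord_re_mem h.cos_theta_pos hu)
  exact (h.differentiableAt_faberFactor hu).mul
    ((h1.ccos.inv h2).mul ((h.differentiableAt_sin_div_cos hu).fun_neg.pow j))

theorem faberFactor_zero (h : LensParams β a θ) : faberFactor a θ 0 = 1 := by
  have hc : (Real.cos θ : ℂ) ≠ 0 := by exact_mod_cast h.cos_theta_pos.ne'
  have ha : (a : ℂ) ≠ 0 := by exact_mod_cast (by linarith [h.one_lt] : a ≠ 0)
  rw [faberFactor, h.lensCoord_zero, sinRatio_zero, zero_sub, Complex.cos_neg,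
    ← Complex.ofReal_cos, Complex.ofReal_div]
  field_simp

theorem analyticAt_of_disc {f : ℂ → ℂ} (hf : ∀ u : ℂ, ‖u‖ < 1 → DifferentiableAt ℂ f u) :
    AnalyticAt ℂ f 0 := by
  have : DifferentiableOn ℂ f (Metric.ball 0 1) := fun u hu =>
    (hf u (by simpa using hu)).differentiableWithinAt
  exact this.analyticAt (Metric.ball_mem_nhds 0 one_pos)

open Filter Topology in
/-- The Taylor coefficients of the generating function are the values of the polynomials. -/
theorem iteratedDeriv_generating (h : LensParams β a θ) (n : ℕ) {R : Type*} [Ring R] [Algebra ℂ R]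
    (S : R) (Q : ℂ → R) (L : R →ₗ[ℂ] ℂ) {g : ℂ → ℂ}
    (hQ : ∀ᶠ u in 𝓝 (0 : ℂ), (Complex.cos (a * lensCoord θ u) • (1 : R) +
      Complex.sin (a * lensCoord θ u) • S) * Q u = 1)
    (hg : g =ᶠ[𝓝 0] fun u => faberFactor a θ u * L (Q u))
    (hL : AnalyticAt ℂ (fun u => L (S ^ (n + 1) * Q u)) 0) :
    iteratedDeriv n g 0 / n.factorial = L (Polynomial.aeval S (lensFaber a θ n)) := by
  have hball : ∀ᶠ u : ℂ in 𝓝 0, ‖u‖ < 1 := by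
    filter_upwards [Metric.ball_mem_nhds (0 : ℂ) one_pos] with u hu
    simpa using hu
  -- The ratio `-tan (a x)` vanishes at `u = 0`. The tail of the geometric series carries its power
  -- `n + 1` and cannot affect the `n`-th coefficient.
  rw [iteratedDeriv_eq_sum_of_eventuallyEq (n := n)
    (τ := fun u => -(Complex.sin (a * lensCoord θ u) / Complex.cos (a * lensCoord θ u)))
    (c := faberCoeffFun a θ) (s := fun j => L (S ^ j))
    (e := fun u => faberFactor a θ u * L (S ^ (n + 1) * Q u))
    (analyticAt_of_disc fun u hu => (h.differentiableAt_sin_div_cos hu).fun_neg)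
    (by simp [h.lensCoord_zero])
    ((analyticAt_of_disc fun u hu => h.differentiableAt_faberFactor hu).fun_mul hL)
    (fun j => analyticAt_of_disc fun u hu => h.differentiableAt_faberCoeffFun j hu)]
  · simp only [lensFaber, map_sum, Polynomial.aeval_monomial, Finset.sum_div,
      ← Algebra.smul_def, map_smul, smul_eq_mul]
    exact Finset.sum_congr rfl fun j _ => by ring
  · filter_upwards [hball, hQ, hg] with u hu hQu hgu
    have hcos := h.cos_mul_ne_zero (lensCoord_re_mem h.cos_theta_pos hu)
    rw [hgu]
    conv_lhs => rw [geometric_expansion hcos hQu n]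
    simp only [map_add, map_sum, map_smul, smul_eq_mul, faberCoeffFun, mul_add, Finset.mul_sum]
    congr 1
    · exact Finset.sum_congr rfl fun j _ => by ring
    · ring

theorem faberFactor_mul_lensKernel (h : LensParams β a θ) (c : ℂ) {u : ℂ} (hu : ‖u‖ < 1) :
    faberFactor a θ u * lensKernel a θ c (lensCoord θ u) = (a / Real.cos θ : ℝ) *
      (Complex.cos (a * lensCoord θ u) + c * Complex.sin (a * lensCoord θ u)) := by
  have h1 := h.cos_sub_theta_ne_zero hu
  have h2 := h.sinRatio_lensCoord_ne_zero hu
  rw [faberFactor, lensKernel]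
  field_simp

end LensParams

/-! ### Faber polynomials of operators. -/

/-- Test `F ξ` against its own direction, rescaled to length `‖ξ‖`, and polarise. By the
parallelogram law the four squared norms add up to `8 ‖ξ‖²`, and a quarter of this gives the factor
2. -/
theorem norm_apply_le_of_norm_inner_le {E : Type*} [NormedAddCommGroup E] [InnerProductSpace ℂ E]
    (F : E →L[ℂ] E) {r : ℝ} (h : ∀ ξ : E, ‖inner ℂ ξ (F ξ)‖ ≤ r * ‖ξ‖ ^ 2) (ξ : E) :
    ‖F ξ‖ ≤ 2 * r * ‖ξ‖ := by
  rcases eq_or_ne (F ξ) 0 with h0 | h0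
  · rcases eq_or_ne ξ 0 with rfl | hξ
    · simp
    · have h1 := h ξ
      have h2 : 0 < ‖ξ‖ := norm_pos_iff.2 hξ
      rw [h0, inner_zero_right, norm_zero] at h1
      rw [h0, norm_zero]
      have : 0 ≤ r := nonneg_of_mul_nonneg_left h1 (by positivity)
      positivity
  · have hn : 0 < ‖F ξ‖ := norm_pos_iff.2 h0
    set x : E := ((‖ξ‖ / ‖F ξ‖ : ℝ) : ℂ) • F ξ with hx
    have hxn : ‖x‖ = ‖ξ‖ := by
      rw [hx, norm_smul, Complex.norm_real, Real.norm_of_nonneg (by positivity)]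
      field_simp
    have h1 := inner_map_polarization (F : E →ₗ[ℂ] E) x ξ
    have h2 : ∀ y : E, ‖inner ℂ (F y) y‖ ≤ r * ‖y‖ ^ 2 := fun y => by
      rw [norm_inner_symm]; exact h y
    have h3 : ‖inner ℂ (F ξ) x‖ = ‖ξ‖ * ‖F ξ‖ := by
      rw [hx, inner_smul_right, inner_self_eq_norm_sq_to_K, norm_mul, Complex.norm_real,
        Real.norm_of_nonneg (by positivity), norm_pow]
      simp
      field_simp
    have p1 := parallelogram_law_with_norm ℂ x ξ
    have p2 := parallelogram_law_with_norm ℂ x (Complex.I • ξ)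
    have hI : ‖Complex.I • ξ‖ = ‖ξ‖ := by rw [norm_smul, Complex.norm_I, one_mul]
    rw [hI, hxn] at p2
    rw [hxn] at p1
    have h4 : ‖inner ℂ (F ξ) x‖ ≤ (r * ‖x + ξ‖ ^ 2 + r * ‖x - ξ‖ ^ 2 +
        r * ‖x + Complex.I • ξ‖ ^ 2 + r * ‖x - Complex.I • ξ‖ ^ 2) / 4 := by
      simp only [ContinuousLinearMap.coe_coe] at h1
      rw [h1, norm_div, Complex.norm_ofNat]
      gcongr
      refine (norm_sub_le _ _).trans (add_le_add ((norm_add_le _ _).trans (add_le_add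
        ((norm_sub_le _ _).trans (add_le_add (h2 _) (h2 _))) ?_)) ?_) <;>
      · rw [norm_mul, Complex.norm_I, one_mul]; exact h2 _
    rw [h3] at h4
    have h5 : ‖ξ‖ * ‖F ξ‖ ≤ ‖ξ‖ * (2 * r * ‖ξ‖) := by
      have : r * ‖x + ξ‖ ^ 2 + r * ‖x - ξ‖ ^ 2 +
        r * ‖x + Complex.I • ξ‖ ^ 2 + r * ‖x - Complex.I • ξ‖ ^ 2 = 8 * r * ‖ξ‖ ^ 2 := by
        linear_combination r * p1 + r * p2
      nlinarith
    have hξ : 0 < ‖ξ‖ := norm_pos_iff.2 (by rintro rfl; simp at h0)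
    exact le_of_mul_le_mul_left h5 hξ

namespace LensParams

variable {β a θ : ℝ} {E : Type*} [NormedAddCommGroup E] [InnerProductSpace ℂ E]

/-- If the numerical range of `T` lies in the lens then the values of the Faber polynomials of the
lens at `T` have numerical radius at most two. -/
theorem norm_inner_lensFaber_le [FiniteDimensional ℂ E] (h : LensParams β a θ)
    {T S : E →L[ℂ] E} (hT : ‖T‖ ≤ 1)
    (hre : ∀ ξ : E, Real.cos β * ‖ξ‖ ^ 2 ≤ (inner ℂ ξ (T ξ)).re)
    (hS : T = (Real.cos β : ℂ) • (1 : E →L[ℂ] E) + (Real.sin β : ℂ) • S)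
    {n : ℕ} (hn : 1 ≤ n) (ξ : E) :
    ‖inner ℂ ξ (Polynomial.aeval S (lensFaber a θ n) ξ)‖ ≤ 2 * ‖ξ‖ ^ 2 := by
  have : CompleteSpace E := FiniteDimensional.complete ℂ E
  have hsβ : 0 < Real.sin β :=
    Real.sin_pos_of_pos_of_lt_pi h.pos (by linarith [h.lt, Real.pi_pos])
  have hcθ := h.cos_theta_pos
  have ha : 0 < a := by linarith [h.one_lt]
  set B : ℂ → E →L[ℂ] E := fun u => Complex.cos (a * lensCoord θ u) • (1 : E →L[ℂ] E) +
      Complex.sin (a * lensCoord θ u) • S with hB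
  -- The Rayleigh quotient `c` of `S` is a point of the lens in chord coordinates, so the scalar
  -- results apply to it.
  have hrange : ∀ η : E, η ≠ 0 → ∃ c : ℂ, 0 ≤ c.re ∧ ‖Real.cos β + c * Real.sin β‖ ≤ 1 ∧
      inner ℂ η (S η) = c * ((‖η‖ ^ 2 : ℝ) : ℂ) := by
    intro η hη
    have hη' : 0 < ‖η‖ ^ 2 := by have := norm_pos_iff.2 hη; positivity
    have hη'' : ((‖η‖ ^ 2 : ℝ) : ℂ) ≠ 0 := by exact_mod_cast hη'.ne'
    obtain ⟨c, hc⟩ : ∃ c, inner ℂ η (S η) = c * ((‖η‖ ^ 2 : ℝ) : ℂ) :=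
      ⟨inner ℂ η (S η) / ((‖η‖ ^ 2 : ℝ) : ℂ), (div_mul_cancel₀ _ hη'').symm⟩
    have hTη : inner ℂ η (T η) = (Real.cos β + c * Real.sin β) * ((‖η‖ ^ 2 : ℝ) : ℂ) := by
      rw [hS]
      simp only [add_apply, smul_apply,
        one_apply_eq_self, inner_add_right, inner_smul_right, hc,
        inner_self_eq_norm_sq_to_K]
      push_cast
      ring_nf
      rfl
    refine ⟨c, ?_, ?_, hc⟩
    · have h1 := hre η
      rw [hTη, Complex.re_mul_ofReal, Complex.add_re, Complex.ofReal_re, Complex.re_mul_ofReal] at h1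
      have h2 := le_of_mul_le_mul_right h1 hη'
      have h3 : 0 ≤ c.re * Real.sin β := by linarith
      exact nonneg_of_mul_nonneg_left h3 hsβ
    · have h1 : ‖inner ℂ η (T η)‖ ≤ 1 * ‖η‖ ^ 2 := by
        calc _ ≤ ‖η‖ * ‖T η‖ := norm_inner_le_norm _ _
          _ ≤ ‖η‖ * (1 * ‖η‖) := by gcongr; exact T.le_of_opNorm_le hT η
          _ = _ := by ring
      rw [hTη, norm_mul, Complex.norm_real, Real.norm_of_nonneg hη'.le] at h1
      exact le_of_mul_le_mul_right h1 hη'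
  have hBη : ∀ (u : ℂ) (η : E) (c : ℂ), inner ℂ η (S η) = c * ((‖η‖ ^ 2 : ℝ) : ℂ) →
      inner ℂ η (B u η) = (Complex.cos (a * lensCoord θ u) + c * Complex.sin (a * lensCoord θ u)) *
        ((‖η‖ ^ 2 : ℝ) : ℂ) := by
    intro u η c hc
    simp only [hB, add_apply, smul_apply,
      one_apply_eq_self, inner_add_right, inner_smul_right, hc,
      inner_self_eq_norm_sq_to_K]
    push_cast
    ring_nf
    rfl
  have hunit : ∀ u : ℂ, ‖u‖ < 1 → IsUnit (B u) := by
    intro u hu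
    have hinj : Function.Injective (B u) := by
      rw [injective_iff_map_eq_zero]
      intro η hη0
      by_contra hη
      obtain ⟨c, hc, hc', hcη⟩ := hrange η hη
      have h1 := hBη u η c hcη
      rw [hη0, inner_zero_right] at h1
      have hη'' : ((‖η‖ ^ 2 : ℝ) : ℂ) ≠ 0 := by
        have := norm_pos_iff.2 hη
        exact_mod_cast (by positivity : ‖η‖ ^ 2 ≠ 0)
      exact mul_ne_zero (h.cos_add_mul_sin_ne_zero hc hc' (lensCoord_re_mem hcθ hu)) hη'' h1.symm
    rw [ContinuousLinearMap.isUnit_iff_bijective]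
    exact ⟨hinj, (LinearMap.injective_iff_surjective (f := (B u : E →ₗ[ℂ] E))).1 hinj⟩
  have hBd : ∀ u : ℂ, ‖u‖ < 1 → DifferentiableAt ℂ B u := by
    intro u hu
    have h1 := (differentiableAt_lensCoord hcθ hu).const_mul (a : ℂ)
    exact (h1.ccos.smul_const _).add (h1.csin.smul_const _)
  have hQd : ∀ u : ℂ, ‖u‖ < 1 → DifferentiableAt ℂ (fun u => Ring.inverse (B u)) u :=
    fun u hu => (differentiableAt_inverse (hunit u hu)).comp u (hBd u hu)
  let L : (E →L[ℂ] E) →L[ℂ] ℂ := (innerSL ℂ ξ).comp (ContinuousLinearMap.apply ℂ E ξ)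
  have hL : ∀ F, L F = inner ℂ ξ (F ξ) := fun F => rfl
  set g : ℂ → ℂ := fun u => faberFactor a θ u * L (Ring.inverse (B u)) with hg
  have hgd : DifferentiableOn ℂ g (Metric.ball 0 1) := fun u hu => by
    have hu' : ‖u‖ < 1 := by simpa using hu
    exact ((h.differentiableAt_faberFactor hu').mul
      (L.differentiableAt.comp u (hQd u hu'))).differentiableWithinAt
  have hgre : ∀ u ∈ Metric.ball (0 : ℂ) 1, 0 ≤ (g u).re := by
    intro u hu
    have hu' : ‖u‖ < 1 := by simpa using hu
    have hBQ : B u * Ring.inverse (B u) = 1 := Ring.mul_inverse_cancel _ (hunit u hu')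
    -- In terms of `η` the form `⟨ξ, B⁻¹ ξ⟩` is the conjugate of `⟨η, B η⟩`, which sees `S` only
    -- through the Rayleigh quotient `c`. This reduces the operator statement to the scalar kernel,
    -- whose conjugate appears in `h5`.
    set η := Ring.inverse (B u) ξ with hη
    have hξη : ξ = B u η := by
      rw [hη, ← mul_apply_eq_comp, hBQ, one_apply_eq_self]
    have hgu : g u = faberFactor a θ u * inner ℂ ξ η := rfl
    rcases eq_or_ne η 0 with h0 | h0
    · rw [hgu, h0, inner_zero_right, mul_zero, Complex.zero_re]
    obtain ⟨c, hc, hc', hcη⟩ := hrange η h0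
    have h1 := hBη u η c hcη
    have h2 := h.faberFactor_mul_lensKernel c hu'
    have h3 := h.lensKernel_re_nonneg hc hc'
      (Set.Ioo_subset_Icc_self (lensCoord_re_mem hcθ hu'))
    rw [← hξη] at h1
    set k := faberFactor a θ u
    set P := lensKernel a θ c (lensCoord θ u)
    have hr : 0 < a / Real.cos θ := by positivity
    have h4 : ((a / Real.cos θ : ℝ) : ℂ) * inner ℂ η ξ = k * P * ((‖η‖ ^ 2 : ℝ) : ℂ) := by
      rw [h1, h2]; ring
    have h5 : ((a / Real.cos θ : ℝ) : ℂ) * g u =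
        ((‖k‖ ^ 2 * ‖η‖ ^ 2 : ℝ) : ℂ) * (starRingEnd ℂ) P := by
      have := congrArg (starRingEnd ℂ) h4
      rw [map_mul, map_mul, map_mul, Complex.conj_ofReal, Complex.conj_ofReal,
        inner_conj_symm] at this
      have hk : k * (starRingEnd ℂ) k = ((‖k‖ ^ 2 : ℝ) : ℂ) := by
        rw [Complex.mul_conj, Complex.normSq_eq_norm_sq]
      rw [hgu]
      push_cast at this hk ⊢
      linear_combination k * this + (starRingEnd ℂ) P * (‖η‖ : ℂ) ^ 2 * hk
    have h6 := congrArg Complex.re h5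
    rw [Complex.re_ofReal_mul, Complex.re_ofReal_mul, Complex.conj_re] at h6
    by_contra hcon
    push Not at hcon
    have h7 := mul_neg_of_pos_of_neg hr hcon
    have h8 : 0 ≤ ‖k‖ ^ 2 * ‖η‖ ^ 2 * P.re := by positivity
    linarith
  have hg0 : g 0 = ((‖ξ‖ ^ 2 : ℝ) : ℂ) := by
    simp only [hg, hB, hL, h.faberFactor_zero, h.lensCoord_zero, mul_zero, Complex.cos_zero,
      Complex.sin_zero, one_smul, zero_smul, add_zero, Ring.inverse_one, one_mul,
      one_apply_eq_self, inner_self_eq_norm_sq_to_K]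
    push_cast; rfl
  have hmain := norm_iteratedDeriv_le_of_re_nonneg hgd hgre hn
  rw [hg0, Complex.ofReal_re] at hmain
  have hcoef := h.iteratedDeriv_generating n S (fun u => Ring.inverse (B u)) (L : _ →ₗ[ℂ] ℂ)
    (g := g) ?_ (Filter.EventuallyEq.refl _ _) ?_
  · rw [hcoef] at hmain
    exact hmain
  · filter_upwards [Metric.ball_mem_nhds (0 : ℂ) one_pos] with u hu
    exact Ring.mul_inverse_cancel _ (hunit u (by simpa using hu))
  · refine analyticAt_of_disc fun u hu => ?_
    exact L.differentiableAt.comp u ((differentiableAt_const (S ^ (n + 1))).mul (hQd u hu))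

end LensParams

/-! ### Values of the Faber polynomials at the origin. -/

-- The function is `-1 / 2 + r / (r - u)`, a geometric series apart from its constant term. Its
-- value `1 / 2` at zero leaves the remainder the value `1 / 2`, which makes the Carathéodory bound
-- equal to 1.
open Filter Topology in
theorem iteratedDeriv_herglotz {r : ℂ} (hr : r ≠ 0) {n : ℕ} (hn : 1 ≤ n) :
    iteratedDeriv n (fun u => (r + u) / (2 * (r - u))) 0 / n.factorial = (r⁻¹) ^ n := by
  have hev : ∀ᶠ u : ℂ in 𝓝 0, r - u ≠ 0 := by
    have : ContinuousAt (fun u : ℂ => r - u) 0 := by fun_prop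
    exact this.eventually_ne (by simpa using hr)
  have h1 : (fun u : ℂ => (r + u) / (2 * (r - u))) =ᶠ[𝓝 0]
      fun u => -(1 / 2) + r / (r - u) := by
    filter_upwards [hev] with u hu
    field_simp
    ring
  rw [h1.iteratedDeriv_eq, iteratedDeriv_const_add (by omega)]
  rw [iteratedDeriv_eq_sum_of_eventuallyEq (n := n) (τ := fun u => u) (c := fun j u => u ^ j)
    (s := fun j => (r⁻¹) ^ j) (e := fun u => (r⁻¹) ^ (n + 1) * (r / (r - u)))
    (by fun_prop) rfl ?_ (fun j => by fun_prop)]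
  · simp only [iteratedDeriv_fun_pow_zero]
    rw [Finset.sum_eq_single n]
    · have : (n.factorial : ℂ) ≠ 0 := by exact_mod_cast n.factorial_ne_zero
      simp only [if_true]
      field_simp
    · intro j _ hj
      rw [if_neg (Ne.symm hj)]; simp
    · simp
  · filter_upwards [hev] with u hu
    have h2 := geom_sum_mul_neg (u * r⁻¹) (n + 1)
    have h3 : 1 - u * r⁻¹ ≠ 0 := by
      intro h0; apply hu; field_simp at h0; simpa using h0
    have h4 : r / (r - u) = (1 - u * r⁻¹)⁻¹ := by field_simp
    simp only [← mul_pow, h4]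
    rw [← mul_assoc, ← mul_pow, (eq_mul_inv_iff_mul_eq₀ h3).2 h2]
    ring
  · exact analyticAt_const.mul (analyticAt_const.div (by fun_prop) (by simpa using hr))

namespace LensParams

variable {β a θ : ℝ}

theorem sin_beta_pos (h : LensParams β a θ) : 0 < Real.sin β :=
  Real.sin_pos_of_pos_of_lt_pi h.pos (by linarith [h.lt, Real.pi_pos])

theorem sin_theta_pos (h : LensParams β a θ) : 0 < Real.sin θ :=
  Real.sin_pos_of_pos_of_lt_pi h.theta_pos (by linarith [h.theta_lt, Real.pi_pos])

/-- In chord coordinates the point `z = 0` sits at `-cot β`. The right side shows the zero `Y = β`,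
reached at `x = 2 θ` because `β = 2 a θ`. -/
theorem cos_add_mul_sin_origin (h : LensParams β a θ) (Y : ℂ) :
    Complex.cos Y + (-(Real.cos β / Real.sin β) : ℂ) * Complex.sin Y =
      -(Complex.sin (Y - β) / Real.sin β) := by
  have hs : (Real.sin β : ℂ) ≠ 0 := by exact_mod_cast h.sin_beta_pos.ne'
  rw [Complex.sin_sub, ← Complex.ofReal_cos, ← Complex.ofReal_sin]
  field_simp
  ring

/-- The generating function at the origin is a multiple of `a cot (a (x - 2 θ)) - a cot (a x)`.
Subtracting the same difference with `a` replaced by 1 removes the poles, and that subtracted part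
equals the explicit fraction in `u` up to the constant `1 / 2`. -/
theorem faberRemainder_lensCoord (h : LensParams β a θ) {u : ℂ} (hu : ‖u‖ < 1)
    (hx2 : lensCoord θ u ≠ ((2 * θ : ℝ) : ℂ)) :
    faberFactor a θ u * (Complex.cos (a * lensCoord θ u) +
      (-(Real.cos β / Real.sin β) : ℂ) * Complex.sin (a * lensCoord θ u))⁻¹ =
    faberRemainder a θ (lensCoord θ u) +
      (((2 * Real.sin θ : ℝ) : ℂ) + u) / (2 * (((2 * Real.sin θ : ℝ) : ℂ) - u)) := by
  have hsβ : (Real.sin β : ℂ) ≠ 0 := by exact_mod_cast h.sin_beta_pos.ne'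
  have hsθ : (Real.sin θ : ℂ) ≠ 0 := by exact_mod_cast h.sin_theta_pos.ne'
  have hcθ : (Real.cos θ : ℂ) ≠ 0 := by exact_mod_cast h.cos_theta_pos.ne'
  have ha := h.one_lt
  rcases eq_or_ne u 0 with rfl | hu0
  · rw [h.faberFactor_zero, h.lensCoord_zero, faberRemainder]
    simp only [mul_zero, Complex.cos_zero, Complex.sin_zero, add_zero, inv_one, zero_mul, zero_div,
      sub_zero]
    push_cast at hsθ ⊢
    field_simp
    norm_num
  have hC := h.cos_sub_theta_ne_zero hu
  have hsin := sin_lensCoord h.cos_theta_pos hu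
  have hmem := Set.Ioo_subset_Icc_self (lensCoord_re_mem h.cos_theta_pos hu)
  have hr1 := h.abs_re_lt hmem
  have hr2 := h.abs_re_sub_lt hmem
  rw [faberFactor, cos_add_mul_sin_origin h]
  generalize lensCoord θ u = x at *
  have hsx : Complex.sin x ≠ 0 := by rw [hsin]; exact mul_ne_zero hu0 hC
  have hx0 : x ≠ 0 := by rintro rfl; simp at hsx
  have hx2' : x - ((2 * θ : ℝ) : ℂ) ≠ 0 := sub_ne_zero.2 hx2
  have hac : (a : ℂ) ≠ 0 := by exact_mod_cast (by linarith : a ≠ 0)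
  have hsin_of : ∀ z : ℂ, z ≠ 0 → a * |z.re| < π →
      Complex.sin z ≠ 0 ∧ Complex.sin (a * z) ≠ 0 := by
    intro z hz hzr
    refine ⟨Complex.sin_ne_zero_of_abs_re_lt_pi hz ?_,
      Complex.sin_ne_zero_of_abs_re_lt_pi (mul_ne_zero hac hz) ?_⟩
    · nlinarith [abs_nonneg z.re]
    · rwa [Complex.re_ofReal_mul, abs_mul, abs_of_pos (show 0 < a by linarith)]
  obtain ⟨-, h1⟩ := hsin_of x hx0 hr1
  obtain ⟨h2, h3⟩ := hsin_of _ hx2' hr2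
  have e1 : (a : ℂ) * (x - ((2 * θ : ℝ) : ℂ)) = a * x - β := by
    rw [h.eq]; push_cast; ring
  have hlog1 := logDeriv_sinRatio ha.le hx2' hr2
  have hlog2 := logDeriv_sinRatio ha.le hx0 hr1
  rw [e1] at hlog1 h3
  have hd : logDeriv (sinRatio a) (x - ((2 * θ : ℝ) : ℂ)) - logDeriv (sinRatio a) x =
      a * (Complex.sin β / (Complex.sin (a * x - β) * Complex.sin (a * x))) -
        Complex.sin ((2 * θ : ℝ) : ℂ) / (Complex.sin (x - ((2 * θ : ℝ) : ℂ)) * Complex.sin x) := by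
    rw [hlog1, hlog2, sub_sub_sub_comm, ← mul_sub, cot_sub_cot h3 h1, cot_sub_cot h2 hsx,
      sub_sub_cancel, sub_sub_cancel]
  have hγ : (((2 * Real.sin θ : ℝ) : ℂ) - u) * Complex.cos (x - θ)
      = -Complex.sin (x - ((2 * θ : ℝ) : ℂ)) := by
    rw [sub_mul, ← hsin]
    obtain ⟨w, hw⟩ : ∃ w, w = x - (θ : ℂ) := ⟨_, rfl⟩
    have e2 : x - ((2 * θ : ℝ) : ℂ) = w - θ := by rw [hw]; push_cast; ring
    have e3 : x = w + θ := by rw [hw]; ring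
    rw [← hw, e2, e3, Complex.sin_add, Complex.sin_sub]; push_cast; ring
  have hγ0 : ((2 * Real.sin θ : ℝ) : ℂ) - u ≠ 0 := by
    intro h0; rw [h0, zero_mul] at hγ; exact h2 (neg_eq_zero.1 hγ.symm)
  have hq : (((2 * Real.sin θ : ℝ) : ℂ) + u) / (2 * (((2 * Real.sin θ : ℝ) : ℂ) - u)) =
      -(1 / 2) - 2 * Real.sin θ * Complex.cos (x - θ) / Complex.sin (x - ((2 * θ : ℝ) : ℂ)) := by
    have : Complex.sin (x - ((2 * θ : ℝ) : ℂ))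
        = -((((2 * Real.sin θ : ℝ) : ℂ) - u) * Complex.cos (x - θ)) := by rw [hγ, neg_neg]
    rw [this]
    push_cast at hγ0 ⊢
    field_simp
    ring
  have h2θ : Complex.sin ((2 * θ : ℝ) : ℂ) = 2 * Real.sin θ * Real.cos θ := by
    rw [← Complex.ofReal_sin, Real.sin_two_mul]; push_cast; ring
  rw [faberRemainder, hd, hq, h2θ, sinRatio_of_ne_zero a hx0, ← Complex.ofReal_sin β,
    Complex.ofReal_div]
  generalize Complex.sin (x - ((2 * θ : ℝ) : ℂ)) = s2 at *
  generalize Complex.sin (a * x - β) = s3 at *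
  generalize Complex.sin (a * x) = s1 at *
  generalize Complex.cos (x - θ) = C at *
  generalize Complex.sin x = sx at *
  field_simp
  ring

open Filter Topology in
/-- The value of the Faber polynomial at the origin is close to the power of the conformal map. -/
theorem norm_eval_lensFaber_sub_le (h : LensParams β a θ) {n : ℕ} (hn : 1 ≤ n) :
    ‖(lensFaber a θ n).eval (-(Real.cos β / Real.sin β) : ℂ) -
      (((2 * Real.sin θ : ℝ) : ℂ)⁻¹) ^ n‖ ≤ 1 := by
  have hγ : ((2 * Real.sin θ : ℝ) : ℂ) ≠ 0 := by
    exact_mod_cast (mul_pos two_pos h.sin_theta_pos).ne'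
  set c : ℂ := (-(Real.cos β / Real.sin β) : ℂ) with hc
  have hX : ∀ u : ℂ, ‖u‖ < 1 → DifferentiableAt ℂ (lensCoord θ) u :=
    fun u hu => differentiableAt_lensCoord h.cos_theta_pos hu
  set k : ℂ → ℂ := fun u => faberRemainder a θ (lensCoord θ u) with hk
  have hkd : ∀ u : ℂ, ‖u‖ < 1 → DifferentiableAt ℂ k u := fun u hu =>
    (h.differentiableAt_faberRemainder (Set.Ioo_subset_Icc_self
      (lensCoord_re_mem h.cos_theta_pos hu))).comp u (hX u hu)
  have hk0 : k 0 = 1 / 2 := by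
    simp only [hk, h.lensCoord_zero, faberRemainder, Complex.sin_zero, zero_mul, zero_div, sub_zero]
  have hbound := norm_iteratedDeriv_le_of_re_nonneg (g := k) (n := n)
    (fun u hu => (hkd u (by simpa using hu)).differentiableWithinAt)
    (fun u hu => h.faberRemainder_re_nonneg (Set.Ioo_subset_Icc_self
      (lensCoord_re_mem h.cos_theta_pos (by simpa using hu)))) hn
  rw [hk0] at hbound
  set q : ℂ → ℂ := fun u =>
    (((2 * Real.sin θ : ℝ) : ℂ) + u) / (2 * (((2 * Real.sin θ : ℝ) : ℂ) - u)) with hq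
  set B : ℂ → ℂ := fun u => Complex.cos (a * lensCoord θ u) + c * Complex.sin (a * lensCoord θ u)
    with hB
  have hball : ∀ᶠ u : ℂ in 𝓝 0, ‖u‖ < 1 := by
    filter_upwards [Metric.ball_mem_nhds (0 : ℂ) one_pos] with u hu
    simpa using hu
  have hXc : ContinuousAt (lensCoord θ) 0 := (hX 0 (by simp)).continuousAt
  have hne : ∀ᶠ u : ℂ in 𝓝 0, lensCoord θ u ≠ ((2 * θ : ℝ) : ℂ) := by
    refine hXc.eventually_ne ?_
    rw [h.lensCoord_zero]
    exact_mod_cast (mul_pos two_pos h.theta_pos).ne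
  have hBa : AnalyticAt ℂ B 0 := analyticAt_of_disc fun u hu => by
    have h1 := (hX u hu).const_mul (a : ℂ)
    exact h1.ccos.add (h1.csin.const_mul c)
  have hB0 : B 0 ≠ 0 := by simp [hB, h.lensCoord_zero]
  have hcoef := h.iteratedDeriv_generating n c (fun u => (B u)⁻¹) LinearMap.id
    (g := fun u => faberFactor a θ u * (B u)⁻¹) ?_ (Filter.EventuallyEq.refl _ _) ?_
  · have hsum : (fun u => faberFactor a θ u * (B u)⁻¹) =ᶠ[𝓝 0] fun u => k u + q u := by
      filter_upwards [hball, hne] with u hu hu2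
      exact h.faberRemainder_lensCoord hu hu2
    have hqa : AnalyticAt ℂ q 0 :=
      AnalyticAt.fun_div (by fun_prop) (by fun_prop) (by simpa using hγ)
    have hadd := iteratedDeriv_add (n := n) (x := (0 : ℂ))
      (analyticAt_of_disc hkd).contDiffAt hqa.contDiffAt
    rw [Pi.add_def] at hadd
    rw [hsum.iteratedDeriv_eq, hadd, add_div, iteratedDeriv_herglotz hγ hn] at hcoef
    rw [LinearMap.id_apply, Polynomial.coe_aeval_eq_eval] at hcoef
    rw [← hcoef, add_sub_cancel_right]
    refine hbound.trans ?_
    norm_num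
  · filter_upwards [hBa.continuousAt.eventually_ne hB0] with u hu
    simp only [smul_eq_mul, mul_one]
    rw [mul_comm _ c]
    exact mul_inv_cancel₀ hu
  · exact analyticAt_const.mul (hBa.inv hB0)

end LensParams

/-! ### Residual polynomials for contractions. -/

open Polynomial in
theorem LensParams.exists_polynomial {β a θ : ℝ} {E : Type*} [NormedAddCommGroup E]
    [InnerProductSpace ℂ E] [FiniteDimensional ℂ E] (h : LensParams β a θ) {T : E →L[ℂ] E}
    (hT : ‖T‖ ≤ 1) (hre : ∀ ξ : E, Real.cos β * ‖ξ‖ ^ 2 ≤ (inner ℂ ξ (T ξ)).re)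
    {n : ℕ} (hn : 1 ≤ n) :
    ∃ p : ℂ[X], p.natDegree ≤ n ∧ p.eval 0 = 1 ∧
      ∀ ξ, ‖aeval T p ξ‖ ≤ 12 * (2 * Real.sin θ) ^ n * ‖ξ‖ := by
  set γ := 2 * Real.sin θ with hγ
  have hγ0 : 0 < γ := mul_pos two_pos h.sin_theta_pos
  have hγn : 0 < γ ^ n := pow_pos hγ0 n
  -- If the target bound is at least 1, the constant polynomial suffices. Otherwise `γ⁻ⁿ ≥ 12`, and
  -- `4 / (γ⁻ⁿ - 1) ≤ 12 γ ^ n` holds already when `γ ^ n ≤ 2 / 3`.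
  rcases le_or_gt 1 (12 * γ ^ n) with hlarge | hsmall
  · refine ⟨1, by simp, by simp, fun ξ => ?_⟩
    rw [map_one, one_apply_eq_self]
    exact le_mul_of_one_le_left (norm_nonneg _) hlarge
  have hsβ : (Real.sin β : ℂ) ≠ 0 := by exact_mod_cast h.sin_beta_pos.ne'
  set S : E →L[ℂ] E := (Real.sin β : ℂ)⁻¹ • (T - (Real.cos β : ℂ) • (1 : E →L[ℂ] E)) with hS
  have hTS : T = (Real.cos β : ℂ) • (1 : E →L[ℂ] E) + (Real.sin β : ℂ) • S := by
    rw [hS, smul_inv_smul₀ hsβ, add_sub_cancel]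
  set F := lensFaber a θ n with hF
  set c : ℂ := (-(Real.cos β / Real.sin β) : ℂ) with hc
  have hup : ∀ ξ : E, ‖aeval S F ξ‖ ≤ 4 * ‖ξ‖ := fun ξ => by
    have := norm_apply_le_of_norm_inner_le (aeval S F)
      (fun ξ => h.norm_inner_lensFaber_le hT hre hTS hn ξ) ξ
    norm_num at this ⊢
    exact this
  have hlow : (γ ^ n)⁻¹ - 1 ≤ ‖F.eval c‖ := by
    have h1 := h.norm_eval_lensFaber_sub_le hn
    have h2 : ‖(((2 * Real.sin θ : ℝ) : ℂ)⁻¹) ^ n‖ = (γ ^ n)⁻¹ := by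
      rw [norm_pow, norm_inv, Complex.norm_real, Real.norm_of_nonneg hγ0.le, inv_pow]
    have h3 := norm_sub_norm_le ((((2 * Real.sin θ : ℝ) : ℂ)⁻¹) ^ n) (F.eval c)
    rw [h2, norm_sub_rev] at h3
    linarith
  have hinv : 12 ≤ (γ ^ n)⁻¹ := by
    rw [le_inv_comm₀ (by norm_num) hγn]
    linarith
  have hF0 : 0 < ‖F.eval c‖ := by linarith
  have hFc : F.eval c ≠ 0 := norm_pos_iff.1 hF0
  set l : ℂ[X] := C (Real.sin β : ℂ)⁻¹ * (X - C (Real.cos β : ℂ)) with hl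
  have hlS : aeval T l = S := by
    rw [hl, hS]
    simp only [map_mul, map_sub, aeval_C, aeval_X, Algebra.algebraMap_eq_smul_one]
    rw [smul_mul_assoc, one_mul]
  refine ⟨C (F.eval c)⁻¹ * F.comp l, ?_, ?_, fun ξ => ?_⟩
  · refine (natDegree_C_mul_le _ _).trans (natDegree_comp_le.trans ?_)
    have h1 : l.natDegree ≤ 1 := (natDegree_C_mul_le _ _).trans (natDegree_X_sub_C_le _)
    calc _ ≤ n * 1 := Nat.mul_le_mul (natDegree_lensFaber_le a θ n) h1
      _ = n := mul_one n
  · rw [eval_mul, eval_C, eval_comp]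
    have : l.eval 0 = c := by
      rw [hl, hc]; simp only [eval_mul, eval_C, eval_sub, eval_X]; field_simp; ring
    rw [this, inv_mul_cancel₀ hFc]
  · rw [map_mul, aeval_C, Algebra.algebraMap_eq_smul_one, smul_mul_assoc, one_mul, aeval_comp, hlS,
      smul_apply, norm_smul, norm_inv]
    have h1 : ‖F.eval c‖⁻¹ * 4 ≤ 12 * γ ^ n := by
      rw [inv_mul_le_iff₀ hF0]
      have h2 : γ ^ n * (γ ^ n)⁻¹ = 1 := mul_inv_cancel₀ hγn.ne'
      nlinarith
    calc _ ≤ ‖F.eval c‖⁻¹ * (4 * ‖ξ‖) := by gcongr; exact hup ξ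
      _ = ‖F.eval c‖⁻¹ * 4 * ‖ξ‖ := by ring
      _ ≤ _ := by gcongr

theorem lensParams_of_angle {β : ℝ} (h0 : 0 < β) (h1 : β < π / 2) :
    LensParams β (2 - β / π) (β / (4 - 2 * β / π)) := by
  have hπ := Real.pi_pos
  have h2 : β / π < 1 := by rw [div_lt_one hπ]; linarith
  have h3 : 4 - 2 * β / π ≠ 0 := by
    rw [mul_div_assoc]; linarith
  refine ⟨h0, h1, ?_, ?_⟩
  · field_simp
  · have : 2 * (2 - β / π) = 4 - 2 * β / π := by ring
    rw [this, mul_div_cancel₀ _ h3]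

/-- This is the degenerate lens `β = 0`, a single point: expanding `‖ξ - T ξ‖²` gives at most zero.
-/
theorem norm_apply_of_re_inner_ge {E : Type*} [NormedAddCommGroup E] [InnerProductSpace ℂ E]
    {T : E →L[ℂ] E} (hT : ‖T‖ ≤ 1) (hre : ∀ ξ : E, ‖ξ‖ ^ 2 ≤ (inner ℂ ξ (T ξ)).re) (ξ : E) :
    T ξ = ξ := by
  have h1 := norm_sub_sq (𝕜 := ℂ) ξ (T ξ)
  have h2 := T.le_of_opNorm_le hT ξ
  have h3 := hre ξ
  have h4 : RCLike.re (inner ℂ ξ (T ξ)) = (inner ℂ ξ (T ξ)).re := rfl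
  have h5 : ‖ξ - T ξ‖ ^ 2 ≤ 0 := by
    rw [h1, h4]; nlinarith [norm_nonneg (T ξ), norm_nonneg ξ]
  have h6 : ‖ξ - T ξ‖ = 0 := by nlinarith [norm_nonneg (ξ - T ξ)]
  exact (sub_eq_zero.1 (norm_eq_zero.1 h6)).symm

theorem gammaRate_zero : gammaRate 0 = 0 := by simp [gammaRate]

theorem gammaRate_mem_Ioo {β : ℝ} (h0 : 0 < β) (h1 : β < π / 2) :
    gammaRate β ∈ Set.Ioo 0 1 := by
  have h := lensParams_of_angle h0 h1
  have hθ := h.theta_lt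
  have := Real.pi_pos
  have h2 : Real.sin (β / (4 - 2 * β / π)) < 1 / 2 := by
    rw [← Real.sin_pi_div_six]
    exact Real.sin_lt_sin_of_lt_of_le_pi_div_two (by linarith [h.theta_pos]) (by linarith) hθ
  exact ⟨mul_pos two_pos h.sin_theta_pos, by unfold gammaRate; linarith⟩

open Polynomial in
/-- Residual polynomials for contractions whose numerical range lies in a half plane. -/
theorem exists_polynomial_of_re_inner_ge {β : ℝ} (hβ : β ∈ Set.Ico 0 (π / 2)) {E : Type*}
    [NormedAddCommGroup E] [InnerProductSpace ℂ E] [FiniteDimensional ℂ E] {T : E →L[ℂ] E}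
    (hT : ‖T‖ ≤ 1) (hre : ∀ ξ : E, Real.cos β * ‖ξ‖ ^ 2 ≤ (inner ℂ ξ (T ξ)).re)
    {n : ℕ} (hn : 1 ≤ n) :
    ∃ p : ℂ[X], p.natDegree ≤ n ∧ p.eval 0 = 1 ∧
      ∀ ξ, ‖aeval T p ξ‖ ≤ 12 * gammaRate β ^ n * ‖ξ‖ := by
  rcases hβ.1.eq_or_lt with rfl | h0
  · refine ⟨1 - X, ?_, by simp, fun ξ => ?_⟩
    · exact (natDegree_sub_le _ _).trans (by simpa using hn)
    · have := norm_apply_of_re_inner_ge hT (by simpa using hre) ξ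
      simp [this, gammaRate_zero, show n ≠ 0 by omega]
  · exact (lensParams_of_angle h0 hβ.2).exists_polynomial hT hre hn

/-! ### Convexity of the numerical range. -/

section NumericalRange

variable {E : Type*} [NormedAddCommGroup E] [InnerProductSpace ℂ E]

theorem exists_inner_eq_of_zero_one (G : E →L[ℂ] E) {x y : E} (hx : ‖x‖ = 1) (hy : ‖y‖ = 1)
    (hGx : inner ℂ x (G x) = 0) (hGy : inner ℂ y (G y) = 1) {s : ℝ} (hs : s ∈ Set.Icc (0 : ℝ) 1) :
    ∃ z : E, z ≠ 0 ∧ inner ℂ z (G z) = ((s * ‖z‖ ^ 2 : ℝ) : ℂ) := by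
  -- The phase `μ` makes the cross term real, so the quadratic form stays real along the segment
  -- from `x` to `μ y`. The intermediate value theorem then applies to the form minus `s ‖z‖²`.
  obtain ⟨μ, hμ, hμr⟩ := Complex.exists_norm_eq_mul_self
    (inner ℂ x (G y) - (starRingEnd ℂ) (inner ℂ y (G x)))
  have hμμ : (starRingEnd ℂ) μ * μ = 1 := by rw [Complex.conj_mul', hμ]; norm_num
  set r : ℂ := μ * inner ℂ x (G y) + (starRingEnd ℂ) μ * inner ℂ y (G x) with hr
  have hrim : r.im = 0 := by
    have h1 : r = (‖inner ℂ x (G y) - (starRingEnd ℂ) (inner ℂ y (G x))‖ : ℂ) +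
        (μ * (starRingEnd ℂ) (inner ℂ y (G x)) +
          (starRingEnd ℂ) (μ * (starRingEnd ℂ) (inner ℂ y (G x)))) := by
      rw [hμr, map_mul, Complex.conj_conj, hr]; ring
    rw [h1, Complex.add_conj, Complex.add_im, Complex.ofReal_im, Complex.ofReal_im, add_zero]
  have hrr : r = (r.re : ℂ) := Complex.ext (by simp) (by simpa using hrim)
  let z : ℝ → E := fun t => ((1 - t : ℝ) : ℂ) • x + ((t : ℂ) * μ) • y
  have hz : ∀ t, inner ℂ (z t) (G (z t)) = ((t ^ 2 + t * (1 - t) * r.re : ℝ) : ℂ) := by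
    intro t
    simp only [z, map_add, map_smul, inner_add_left, inner_add_right, inner_smul_left,
      inner_smul_right, hGx, hGy, map_mul, Complex.conj_ofReal]
    push_cast
    rw [← hrr, hr]
    linear_combination (t : ℂ) ^ 2 * hμμ
  have hcont : Continuous fun t : ℝ => (t ^ 2 + t * (1 - t) * r.re) - s * ‖z t‖ ^ 2 := by
    have : Continuous z := by fun_prop
    fun_prop
  have h0 : z 0 = x := by simp [z]
  have h1 : z 1 = μ • y := by simp [z]
  obtain ⟨t, ht, hzero⟩ := intermediate_value_Icc zero_le_one hcont.continuousOn
    (show (0 : ℝ) ∈ _ from ⟨by simp [h0, hx, hs.1], by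
      simp only [h1, norm_smul, hμ, hy]; norm_num; exact hs.2⟩)
  refine ⟨z t, fun hzt => ?_, ?_⟩
  · have hx' : inner ℂ x (G x) * ((1 - t : ℝ) : ℂ) ^ 2 = (t : ℂ) ^ 2 := by
      have e : ((1 - t : ℝ) : ℂ) • x = -(((t : ℂ) * μ) • y) := eq_neg_of_add_eq_zero_left hzt
      have e2 : inner ℂ (((1 - t : ℝ) : ℂ) • x) (G (((1 - t : ℝ) : ℂ) • x)) =
          inner ℂ (-(((t : ℂ) * μ) • y)) (G (-(((t : ℂ) * μ) • y))) := by rw [e]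
      simp only [map_neg, inner_neg_neg, map_smul, inner_smul_left, inner_smul_right, hGy, hGx,
        map_mul, Complex.conj_ofReal] at e2
      rw [hGx]
      linear_combination (t : ℂ) ^ 2 * hμμ + e2
    rw [hGx, zero_mul] at hx'
    have ht0 : t = 0 := by exact_mod_cast (pow_eq_zero_iff two_ne_zero).1 hx'.symm
    rw [ht0, h0] at hzt
    rw [hzt, norm_zero] at hx
    exact zero_ne_one hx
  · rw [hz t]
    congr 1
    simp only at hzero
    linarith

/-- The Toeplitz–Hausdorff theorem: the numerical range is convex. -/
theorem convex_numericalRange (F : E →L[ℂ] E) :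
    Convex ℝ {w : ℂ | ∃ ξ : E, ‖ξ‖ = 1 ∧ inner ℂ ξ (F ξ) = w} := by
  rintro a ⟨x, hx, rfl⟩ b ⟨y, hy, rfl⟩ p s hp hs hps
  set a := inner ℂ x (F x) with ha
  set b := inner ℂ y (F y) with hb
  rcases eq_or_ne a b with hab | hab
  · refine ⟨x, hx, ?_⟩
    rw [← hab, ← add_smul, hps, one_smul]
  have hba : b - a ≠ 0 := sub_ne_zero.2 hab.symm
  set G : E →L[ℂ] E := (b - a)⁻¹ • (F - a • (1 : E →L[ℂ] E)) with hG
  have hGin : ∀ ξ : E, inner ℂ ξ (G ξ) = (b - a)⁻¹ * (inner ℂ ξ (F ξ) - a * ((‖ξ‖ ^ 2 : ℝ) : ℂ)) := by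
    intro ξ
    simp only [hG, smul_apply, sub_apply, one_apply_eq_self, inner_smul_right, inner_sub_right,
      inner_self_eq_norm_sq_to_K]
    push_cast
    rfl
  obtain ⟨z, hz0, hz⟩ := exists_inner_eq_of_zero_one G hx hy
    (by rw [hGin, hx, ← ha]; simp) (by rw [hGin, hy, ← hb]; simp [hba]) ⟨hs, by linarith⟩
  have hzn : 0 < ‖z‖ := norm_pos_iff.2 hz0
  have hznc : (‖z‖ : ℂ) ≠ 0 := by exact_mod_cast hzn.ne'
  refine ⟨((‖z‖⁻¹ : ℝ) : ℂ) • z, ?_, ?_⟩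
  · rw [norm_smul, Complex.norm_real, Real.norm_of_nonneg (by positivity),
      inv_mul_cancel₀ hzn.ne']
  · have h1 : inner ℂ z (F z) = (a + (b - a) * s) * (‖z‖ : ℂ) ^ 2 := by
      rw [hGin, inv_mul_eq_iff_eq_mul₀ hba] at hz
      push_cast at hz
      linear_combination hz
    rw [map_smul, inner_smul_left, inner_smul_right, h1, Complex.conj_ofReal, Complex.real_smul,
      Complex.real_smul]
    have hp' : (p : ℂ) = 1 - s := by rw [eq_sub_iff_add_eq]; exact_mod_cast hps
    rw [hp']
    push_cast
    field_simp
    ring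

/-- If the numerical range avoids a disc about the origin then a rotation moves it to a half
plane. -/
theorem exists_rotation_re_inner_ge (F : E →L[ℂ] E) {c : ℝ} (hc : 0 < c)
    (hF : ∀ ξ : E, c * ‖ξ‖ ^ 2 ≤ ‖inner ℂ ξ (F ξ)‖) :
    ∃ e : ℂ, ‖e‖ = 1 ∧ ∀ ξ : E, c * ‖ξ‖ ^ 2 ≤ (e * inner ℂ ξ (F ξ)).re := by
  by_cases hE : ∃ ξ : E, ξ ≠ 0
  swap
  · push Not at hE
    exact ⟨1, norm_one, fun ξ => by simp [hE ξ]⟩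
  obtain ⟨f, u, hf1, hf2⟩ := geometric_hahn_banach_open (convex_ball (0 : ℂ) c) Metric.isOpen_ball
    (convex_numericalRange F) (by
      rw [Set.disjoint_left]
      rintro w hw ⟨ξ, hξ, rfl⟩
      have := hF ξ
      rw [hξ] at this
      simp at hw
      linarith)
  have hunit : ∀ ξ : E, ξ ≠ 0 → u * ‖ξ‖ ^ 2 ≤ f (inner ℂ ξ (F ξ)) := by
    intro ξ hξ
    have hn : 0 < ‖ξ‖ := norm_pos_iff.2 hξ
    have h1 := hf2 (inner ℂ (((‖ξ‖⁻¹ : ℝ) : ℂ) • ξ) (F (((‖ξ‖⁻¹ : ℝ) : ℂ) • ξ)))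
      ⟨_, by rw [norm_smul, Complex.norm_real, Real.norm_of_nonneg (by positivity),
        inv_mul_cancel₀ hn.ne'], rfl⟩
    rw [map_smul, inner_smul_left, inner_smul_right, Complex.conj_ofReal, ← Complex.real_smul,
      ← Complex.real_smul, map_smul, map_smul, smul_eq_mul, smul_eq_mul] at h1
    have h2 := mul_le_mul_of_nonneg_right h1 (sq_nonneg ‖ξ‖)
    refine h2.trans (le_of_eq ?_)
    field_simp
  set w : ℂ := f 1 - f Complex.I * Complex.I with hw
  have hfw : ∀ z : ℂ, f z = (w * z).re := by
    intro z
    have hz : z = z.re • (1 : ℂ) + z.im • Complex.I := by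
      rw [Complex.real_smul, Complex.real_smul, mul_one, Complex.re_add_im]
    conv_lhs => rw [hz]
    rw [map_add, map_smul, map_smul, hw]
    simp
    ring
  have hu : 0 < u := by simpa using hf1 0 (by simpa using hc)
  obtain ⟨ξ₀, hξ₀⟩ := hE
  have hw0 : w ≠ 0 := by
    intro h0
    have h1 := hunit ξ₀ hξ₀
    rw [hfw, h0, zero_mul, Complex.zero_re] at h1
    have := norm_pos_iff.2 hξ₀
    have : 0 < u * ‖ξ₀‖ ^ 2 := by positivity
    linarith
  have hwn : 0 < ‖w‖ := norm_pos_iff.2 hw0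
  obtain ⟨e, he, hew⟩ := Complex.exists_norm_eq_mul_self w
  -- The separating functional is `z ↦ re (w z)`, whose supremum over the disc is `c ‖w‖`. This
  -- transfers the full radius `c` to the half plane.
  have hcu : c * ‖w‖ ≤ u := by
    have hr : ∀ r ∈ Set.Ioo 0 c, r * ‖w‖ ≤ u := by
      intro r hr
      have h1 := hf1 (r * e) (by
        rw [mem_ball_zero_iff, norm_mul, he, mul_one, Complex.norm_real,
          Real.norm_of_nonneg hr.1.le]
        exact hr.2)
      have h2 : w * (r * e) = ((r * ‖w‖ : ℝ) : ℂ) := by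
        push_cast; rw [hew]; ring
      rw [hfw, h2, Complex.ofReal_re] at h1
      exact h1.le
    have hlim : Filter.Tendsto (fun r : ℝ => r * ‖w‖) (nhdsWithin c (Set.Iio c))
        (nhds (c * ‖w‖)) :=
      (Continuous.tendsto (by fun_prop) c).mono_left nhdsWithin_le_nhds
    refine le_of_tendsto hlim ?_
    filter_upwards [Ioo_mem_nhdsLT hc] with r hr' using hr r hr'
  refine ⟨(‖w‖ : ℂ)⁻¹ * w, ?_, fun ξ => ?_⟩
  · rw [norm_mul, norm_inv, Complex.norm_real, norm_norm, inv_mul_cancel₀ hwn.ne']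
  · rcases eq_or_ne ξ 0 with rfl | hξ
    · simp
    · have h1 := hunit ξ hξ
      rw [hfw] at h1
      rw [mul_assoc, ← Complex.ofReal_inv, Complex.re_ofReal_mul, le_inv_mul_iff₀ hwn]
      calc _ = c * ‖w‖ * ‖ξ‖ ^ 2 := by ring
        _ ≤ u * ‖ξ‖ ^ 2 := by gcongr
        _ ≤ _ := h1

end NumericalRange

/-! ### GMRES and residual polynomials. -/

section GMRES

variable {n : ℕ} {C : Matrix (Fin n) (Fin n) ℂ} {d : Fin n → ℂ} {m : ℕ}

/-- The residual is minimised by projecting `d` onto the image of the Krylov space. For two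
minimisers the parallelogram law at their midpoint forces equal images, and injectivity gives equal
iterates. -/
theorem existsUnique_isGMRESIterate (hC : Function.Injective C.mulVec) :
    ∃! y, IsGMRESIterate C d m y := by
  set K := krylov C (C.mulVec 0 - d) m with hK
  let L : (Fin n → ℂ) →ₗ[ℂ] EuclideanSpace ℂ (Fin n) :=
    (WithLp.linearEquiv 2 ℂ (Fin n → ℂ)).symm.toLinearMap ∘ₗ C.mulVecLin
  have hL : ∀ v, L v = WithLp.toLp 2 (C.mulVec v) := fun v => rfl
  have hn : ∀ v, norm2 (C.mulVec v - d) = ‖WithLp.toLp 2 d - L v‖ := fun v => by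
    rw [hL, norm2, WithLp.toLp_sub, norm_sub_rev]
  have hcomplete : IsComplete ((K.map L : Submodule ℂ _) : Set (EuclideanSpace ℂ (Fin n))) :=
    Submodule.complete_of_finiteDimensional _
  obtain ⟨_, ⟨y, hyK, rfl⟩, hy⟩ :=
    (K.map L).exists_norm_eq_iInf_of_complete_subspace hcomplete (WithLp.toLp 2 d)
  have hbdd : BddBelow (Set.range fun w : (K.map L : Submodule ℂ _) =>
      ‖WithLp.toLp 2 d - (w : EuclideanSpace ℂ (Fin n))‖) :=
    ⟨0, by rintro _ ⟨w, rfl⟩; exact norm_nonneg _⟩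
  refine ⟨y, ⟨hyK, fun z hz => ?_⟩, fun y' hy' => ?_⟩
  · rw [hn, hn, hy]
    exact ciInf_le hbdd ⟨L z, Submodule.mem_map_of_mem hz⟩
  · have hle1 : norm2 (C.mulVec y' - d) ≤ norm2 (C.mulVec y - d) := hy'.2 y hyK
    have hmid : (2⁻¹ : ℂ) • (y + y') ∈ K := K.smul_mem _ (K.add_mem hyK hy'.1)
    have hle2 : norm2 (C.mulVec y - d) ≤ norm2 (C.mulVec ((2⁻¹ : ℂ) • (y + y')) - d) := by
      rw [hn, hn, hy]
      exact ciInf_le hbdd ⟨L _, Submodule.mem_map_of_mem hmid⟩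
    set a := WithLp.toLp 2 d - L y with ha
    set b := WithLp.toLp 2 d - L y' with hb
    have hab : WithLp.toLp 2 d - L ((2⁻¹ : ℂ) • (y + y')) = (2⁻¹ : ℂ) • (a + b) := by
      rw [map_smul, map_add, ha, hb]
      module
    rw [hn, hn] at hle1 hle2
    rw [hab, norm_smul, norm_inv, Complex.norm_ofNat] at hle2
    have hp := parallelogram_law_with_norm ℂ a b
    have h1 : ‖a - b‖ ^ 2 ≤ 0 := by nlinarith [norm_nonneg a, norm_nonneg b, norm_nonneg (a + b)]
    have h2 : a - b = 0 := by
      rw [← norm_eq_zero]; nlinarith [norm_nonneg (a - b)]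
    have h3 : L y' = L y := by
      have h4 : a - b = L y' - L y := by rw [ha, hb]; abel
      rw [h4] at h2
      exact sub_eq_zero.1 h2
    rw [hL, hL] at h3
    exact hC ((WithLp.toLp_injective 2) h3)

open Polynomial in
/-- The residual of a GMRES iterate is bounded by every residual polynomial. -/
theorem norm2_residual_le_aeval {y : Fin n → ℂ} (hy : IsGMRESIterate C d m y) (hm : 1 ≤ m)
    {p : ℂ[X]} (hp : p.natDegree ≤ m) (hp0 : p.eval 0 = 1) :
    norm2 (C.mulVec y - d) ≤
      ‖aeval (Matrix.toEuclideanCLM (𝕜 := ℂ) C) p (WithLp.toLp 2 d)‖ := by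
  -- Writing `p = 1 + X q`, the vector `-q(C) d` lies in the Krylov space and has residual `-p(C)
  -- d`.
  set z : Fin n → ℂ := -((aeval C p.divX).mulVec d) with hz
  have hzK : z ∈ krylov C (C.mulVec 0 - d) m := by
    have hdeg : p.divX.natDegree < m := by
      rw [natDegree_divX_eq_natDegree_tsub_one]; omega
    rw [hz, aeval_eq_sum_range' hdeg, Matrix.sum_mulVec]
    refine neg_mem (Submodule.sum_mem _ fun j hj => ?_)
    have h1 : ((p.divX.coeff j) • C ^ j).mulVec d =
        (-(p.divX.coeff j)) • (C ^ j).mulVec (C.mulVec 0 - d) := by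
      rw [Matrix.mulVec_zero, zero_sub, Matrix.mulVec_neg, Matrix.smul_mulVec, neg_smul_neg]
    rw [h1]
    exact Submodule.smul_mem _ _ (Submodule.subset_span ⟨j, Finset.mem_range.1 hj, rfl⟩)
  have hres : C.mulVec z - d = -((aeval C p).mulVec d) := by
    have h1 : aeval C p = C * aeval C p.divX + 1 := by
      conv_lhs => rw [← divX_mul_X_add p, mul_comm p.divX X]
      rw [coeff_zero_eq_eval_zero, hp0, map_one, map_add, map_mul, aeval_X, map_one]
    rw [hz, h1, Matrix.mulVec_neg, Matrix.mulVec_mulVec, Matrix.add_mulVec, Matrix.one_mulVec]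
    abel
  refine (hy.2 z hzK).trans (le_of_eq ?_)
  rw [hres, norm2, WithLp.toLp_neg, norm_neg]
  have := aeval_algHom_apply (Matrix.toEuclideanCLM (𝕜 := ℂ) (n := Fin n)) C p
  rw [this, Matrix.toEuclideanCLM_toLp]

open Polynomial in
/-- Convergence of GMRES for matrices whose numerical range avoids a disc about the origin. -/
theorem norm2_residual_le_gammaRate {β μ c : ℝ} (hβ : β ∈ Set.Ico 0 (π / 2)) (hμ : 0 < μ)
    (hc : 0 < c) (hcos : Real.cos β = c / μ)
    (hup : ‖Matrix.toEuclideanCLM (𝕜 := ℂ) C‖ ≤ μ)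
    (hlow : ∀ ξ : EuclideanSpace ℂ (Fin n),
      c * ‖ξ‖ ^ 2 ≤ ‖inner ℂ ξ (Matrix.toEuclideanCLM (𝕜 := ℂ) C ξ)‖)
    {y : Fin n → ℂ} (hy : IsGMRESIterate C d m y) (hm : 1 ≤ m) :
    norm2 (C.mulVec y - d) ≤ 12 * gammaRate β ^ m * norm2 d := by
  set F := Matrix.toEuclideanCLM (𝕜 := ℂ) C with hF
  obtain ⟨e, he, hre⟩ := exists_rotation_re_inner_ge F hc hlow
  -- Rotation and scaling make `l • F` a contraction with numerical range in the half plane `cos β ≤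
  -- re z`. Substituting `l X` preserves both the degree bound and the value at zero.
  set l : ℂ := ((μ⁻¹ : ℝ) : ℂ) * e with hl
  obtain ⟨p, hp, hp0, hpT⟩ := exists_polynomial_of_re_inner_ge (T := l • F) hβ
    (by
      rw [norm_smul, hl, norm_mul, he, mul_one, Complex.norm_real,
        Real.norm_of_nonneg (by positivity), inv_mul_le_iff₀ hμ, mul_one]
      exact hup)
    (fun ξ => by
      rw [smul_apply, inner_smul_right, hl, mul_assoc, Complex.re_ofReal_mul, hcos,
        le_inv_mul_iff₀ hμ]
      refine le_trans (le_of_eq ?_) (hre ξ)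
      field_simp) hm
  have haev : aeval F (p.comp (Polynomial.C l * X)) = aeval (l • F) p := by
    rw [aeval_comp, map_mul, aeval_C, aeval_X, ← Algebra.smul_def]
  have h1 := norm2_residual_le_aeval hy hm (p := p.comp (Polynomial.C l * X))
    (natDegree_comp_le.trans (by
      calc _ ≤ m * 1 := Nat.mul_le_mul hp ((natDegree_C_mul_le l X).trans natDegree_X_le)
        _ = m := mul_one m))
    (by rw [eval_comp]; simpa using hp0)
  rw [← hF, haev] at h1
  exact h1.trans (hpT _)

end GMRES

/-! ### Scaled Galerkin systems. -/

section Galerkin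

variable {H : Type*} [NormedAddCommGroup H] [InnerProductSpace ℂ H] {n : ℕ} {V : Submodule ℂ H}

theorem sqrtDiag_mulVec_invSqrtDiag {d : Fin n → ℝ} (hd : ∀ j, 0 < d j) (v : Fin n → ℂ) :
    (sqrtDiag d).mulVec ((invSqrtDiag d).mulVec v) = v := by
  ext j
  have : ((√(d j) : ℝ) : ℂ) ≠ 0 := by exact_mod_cast (Real.sqrt_pos.2 (hd j)).ne'
  simp only [sqrtDiag, invSqrtDiag, Matrix.mulVec_diagonal, Complex.ofReal_inv]
  rw [mul_inv_cancel_left₀ this]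

theorem invSqrtDiag_mulVec_sqrtDiag {d : Fin n → ℝ} (hd : ∀ j, 0 < d j) (v : Fin n → ℂ) :
    (invSqrtDiag d).mulVec ((sqrtDiag d).mulVec v) = v := by
  ext j
  have : ((√(d j) : ℝ) : ℂ) ≠ 0 := by exact_mod_cast (Real.sqrt_pos.2 (hd j)).ne'
  simp only [sqrtDiag, invSqrtDiag, Matrix.mulVec_diagonal, Complex.ofReal_inv]
  rw [inv_mul_cancel_left₀ this]

theorem synth_sub (ψ : Module.Basis (Fin n) ℂ V) (v w : Fin n → ℂ) :
    synth ψ (v - w) = synth ψ v - synth ψ w := by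
  simp [synth, sub_smul, Finset.sum_sub_distrib]

theorem inner_synth (ψ : Module.Basis (Fin n) ℂ V) (w : Fin n → ℂ) (g : H) :
    inner ℂ (synth ψ w) g = ∑ i, inner ℂ (ψ i : H) g * (starRingEnd ℂ) (w i) := by
  simp only [synth, sum_inner, inner_smul_left]
  exact Finset.sum_congr rfl fun i _ => mul_comm _ _

theorem galerkinMatrix_mulVec (A : H →L[ℂ] H) (ψ : Module.Basis (Fin n) ℂ V) (v : Fin n → ℂ) :
    (galerkinMatrix A ψ).mulVec v = galerkinRhs (A (synth ψ v)) ψ := by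
  ext i
  simp only [galerkinMatrix, galerkinRhs, synth, Matrix.mulVec, dotProduct, Matrix.of_apply,
    map_sum, map_smul, inner_sum, inner_smul_right]
  exact Finset.sum_congr rfl fun j _ => mul_comm _ _

/-- The map from scaled coefficient vectors to the Galerkin space. -/
noncomputable def scaledSynth (ψ : Module.Basis (Fin n) ℂ V) (d : Fin n → ℝ) (v : Fin n → ℂ) : H :=
  synth ψ ((invSqrtDiag d).mulVec v)

/-- Forming the scaled right-hand side is adjoint to scaled synthesis. The scaled matrix is thus
synthesis, then `A`, then the adjoint, which is how norm bounds and coercivity pass to it. -/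
theorem inner_toLp_scaledRhs (f : H) (ψ : Module.Basis (Fin n) ℂ V) (d : Fin n → ℝ)
    (w : Fin n → ℂ) :
    inner ℂ (WithLp.toLp 2 w) (WithLp.toLp 2 (scaledRhs f ψ d)) =
      inner ℂ (scaledSynth ψ d w) f := by
  rw [scaledSynth, inner_synth, EuclideanSpace.inner_toLp_toLp]
  refine Finset.sum_congr rfl fun i _ => ?_
  simp only [scaledRhs, invSqrtDiag, Matrix.mulVec_diagonal, galerkinRhs, map_mul,
    Complex.conj_ofReal, Pi.star_apply]
  rw [← starRingEnd_apply]
  ring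

theorem scaledMatrix_mulVec (A : H →L[ℂ] H) (ψ : Module.Basis (Fin n) ℂ V) (d : Fin n → ℝ)
    (v : Fin n → ℂ) :
    (scaledMatrix A ψ d).mulVec v = scaledRhs (A (scaledSynth ψ d v)) ψ d := by
  rw [scaledMatrix, ← Matrix.mulVec_mulVec, ← Matrix.mulVec_mulVec, galerkinMatrix_mulVec]
  rfl

theorem exists_scaledSynth_eq (ψ : Module.Basis (Fin n) ℂ V) {d : Fin n → ℝ} (hd : ∀ j, 0 < d j)
    (χ : V) : ∃ v, scaledSynth ψ d v = χ := by
  refine ⟨(sqrtDiag d).mulVec (ψ.equivFun χ), ?_⟩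
  rw [scaledSynth, invSqrtDiag_mulVec_sqrtDiag hd, synth]
  have h := congrArg V.subtype (ψ.sum_equivFun χ)
  rw [map_sum] at h
  exact h

theorem scaledSynth_mem (ψ : Module.Basis (Fin n) ℂ V) (d : Fin n → ℝ) (v : Fin n → ℂ) :
    scaledSynth ψ d v ∈ V := by
  unfold scaledSynth synth
  exact V.sum_mem fun j _ => V.smul_mem _ (ψ j).2

end Galerkin

/-! ### Bounds for one Galerkin space. -/

namespace GalerkinGMRES

/-- The norm equivalence on one Galerkin space, for scaled coefficient vectors. -/
structure ScaledBounds {H : Type*} [NormedAddCommGroup H] [InnerProductSpace ℂ H] {n : ℕ}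
    {V : Submodule ℂ H} (ψ : Module.Basis (Fin n) ℂ V) (d : Fin n → ℝ) (C₁ C₂ : ℝ) : Prop where
  pos₁ : 0 < C₁
  pos₂ : 0 < C₂
  diag_pos : ∀ j, 0 < d j
  lower : ∀ v, C₁ * norm2 v ≤ ‖scaledSynth ψ d v‖
  upper : ∀ v, ‖scaledSynth ψ d v‖ ≤ C₂ * norm2 v

section

variable {H : Type*} [NormedAddCommGroup H] [InnerProductSpace ℂ H]

theorem NormEquivalence.scaledBounds {M : ℕ → ℕ} {V : ℕ → Submodule ℂ H}
    {ψ : ∀ N, Module.Basis (Fin (M N)) ℂ (V N)} {d : ∀ N, Fin (M N) → ℝ} {C₁ C₂ : ℝ}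
    (h : NormEquivalence ψ d C₁ C₂) (N : ℕ) : ScaledBounds (ψ N) (d N) C₁ C₂ := by
  obtain ⟨h1, h2, h3, h4⟩ := h
  have key : ∀ v, C₁ * norm2 v ≤ ‖scaledSynth (ψ N) (d N) v‖ ∧
      ‖scaledSynth (ψ N) (d N) v‖ ≤ C₂ * norm2 v := fun v => by
    have := h4 N ((invSqrtDiag (d N)).mulVec v)
    rwa [sqrtDiag_mulVec_invSqrtDiag (h3 N)] at this
  exact ⟨h1, h2, h3 N, fun v => (key v).1, fun v => (key v).2⟩

variable {n : ℕ} {V : Submodule ℂ H} {ψ : Module.Basis (Fin n) ℂ V} {d : Fin n → ℝ}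
  {C₁ C₂ c : ℝ} {A : H →L[ℂ] H}

theorem ScaledBounds.norm2_scaledRhs_le (h : ScaledBounds ψ d C₁ C₂) (f : H) :
    norm2 (scaledRhs f ψ d) ≤ C₂ * ‖f‖ := by
  set b := scaledRhs f ψ d with hb
  have h1 : norm2 b ^ 2 ≤ C₂ * norm2 b * ‖f‖ := by
    have h2 := inner_toLp_scaledRhs f ψ d b
    rw [← hb, inner_self_eq_norm_sq_to_K] at h2
    have h3 : norm2 b ^ 2 = ‖inner ℂ (scaledSynth ψ d b) f‖ := by
      rw [← h2, norm_pow]; simp [norm2]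
    rw [h3]
    exact (norm_inner_le_norm _ _).trans
      (mul_le_mul_of_nonneg_right (h.upper b) (norm_nonneg f))
  have h0 : 0 ≤ norm2 b := norm_nonneg _
  rcases h0.eq_or_lt with h00 | h00
  · rw [← h00]; have := h.pos₂; positivity
  · nlinarith

theorem ScaledBounds.opNorm_le (h : ScaledBounds ψ d C₁ C₂) (A : H →L[ℂ] H) :
    ‖Matrix.toEuclideanCLM (𝕜 := ℂ) (scaledMatrix A ψ d)‖ ≤ ‖A‖ * C₂ ^ 2 := by
  have hC := h.pos₂
  refine ContinuousLinearMap.opNorm_le_bound _ (by positivity) fun x => ?_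
  obtain ⟨v, rfl⟩ : ∃ v, x = WithLp.toLp 2 v := ⟨x.ofLp, rfl⟩
  rw [Matrix.toEuclideanCLM_toLp, scaledMatrix_mulVec]
  calc norm2 (scaledRhs (A (scaledSynth ψ d v)) ψ d) ≤ C₂ * ‖A (scaledSynth ψ d v)‖ :=
        h.norm2_scaledRhs_le _
    _ ≤ C₂ * (‖A‖ * (C₂ * norm2 v)) := by
        gcongr
        exact (A.le_opNorm _).trans (by gcongr; exact h.upper v)
    _ = _ := by rw [norm2]; ring

theorem ScaledBounds.le_norm_inner (h : ScaledBounds ψ d C₁ C₂) (hA : IsCoerciveWith A c)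
    (v : Fin n → ℂ) : c * C₁ ^ 2 * norm2 v ^ 2 ≤ ‖inner ℂ (WithLp.toLp 2 v)
      (WithLp.toLp 2 ((scaledMatrix A ψ d).mulVec v))‖ := by
  rw [scaledMatrix_mulVec, inner_toLp_scaledRhs]
  refine le_trans ?_ (hA.2 _)
  have h1 := h.lower v
  have h2 : 0 ≤ norm2 v := norm_nonneg _
  have hc := hA.1
  have hC := h.pos₁
  calc _ = c * (C₁ * norm2 v) ^ 2 := by ring
    _ ≤ _ := by gcongr

theorem ScaledBounds.mul_norm2_le (h : ScaledBounds ψ d C₁ C₂) (hA : IsCoerciveWith A c)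
    (v : Fin n → ℂ) : c * C₁ ^ 2 * norm2 v ≤ norm2 ((scaledMatrix A ψ d).mulVec v) := by
  have h1 := (h.le_norm_inner hA v).trans (norm_inner_le_norm _ _)
  have h0 : 0 ≤ norm2 v := norm_nonneg _
  rcases h0.eq_or_lt with h00 | h00
  · rw [← h00, mul_zero]; exact norm_nonneg _
  · refine le_of_mul_le_mul_left (le_of_eq_of_le ?_ h1) h00
    change norm2 v * _ = _
    ring

theorem ScaledBounds.mulVec_injective (h : ScaledBounds ψ d C₁ C₂) (hA : IsCoerciveWith A c) :
    Function.Injective (scaledMatrix A ψ d).mulVec := by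
  intro v w hvw
  have h1 := h.mul_norm2_le hA (v - w)
  rw [Matrix.mulVec_sub, sub_eq_zero.2 hvw] at h1
  have h2 : norm2 (0 : Fin n → ℂ) = 0 := by simp [norm2]
  rw [h2] at h1
  have h3 : norm2 (v - w) ≤ 0 :=
    nonpos_of_mul_nonpos_right h1 (mul_pos hA.1 (pow_pos h.pos₁ 2))
  have h4 : WithLp.toLp 2 (v - w) = 0 := norm_le_zero_iff.1 h3
  exact sub_eq_zero.1 ((WithLp.toLp_injective 2) (h4.trans (WithLp.toLp_zero 2).symm))

/-- Céa's lemma for the Galerkin solution. -/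
theorem ScaledBounds.norm_sub_galerkin_le (h : ScaledBounds ψ d C₁ C₂) (hA : IsCoerciveWith A c)
    {φ : H} {y : Fin n → ℂ}
    (hy : (scaledMatrix A ψ d).mulVec y = scaledRhs (A φ) ψ d) (χ : V) :
    ‖φ - scaledSynth ψ d y‖ ≤ ‖A‖ / c * ‖φ - χ‖ := by
  set e := φ - scaledSynth ψ d y with he
  have horth : ∀ η : V, inner ℂ (η : H) (A e) = 0 := by
    intro η
    obtain ⟨w, hw⟩ := exists_scaledSynth_eq ψ h.diag_pos η
    rw [he, map_sub, inner_sub_right, ← hw, ← inner_toLp_scaledRhs, ← inner_toLp_scaledRhs,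
      ← scaledMatrix_mulVec, hy, sub_self]
  -- Galerkin orthogonality: `e` and `φ - χ` differ by an element of the subspace.
  have h1 : inner ℂ e (A e) = inner ℂ (φ - χ) (A e) := by
    have h2 : e = (φ - χ) + ((χ - ⟨_, scaledSynth_mem ψ d y⟩ : V) : H) := by
      rw [he]; simp
    conv_lhs => rw [h2, inner_add_left]
    rw [← h2, horth, add_zero]
  have h3 : c * ‖e‖ ^ 2 ≤ ‖φ - χ‖ * (‖A‖ * ‖e‖) := by
    refine (hA.2 e).trans ?_
    rw [h1]
    refine (norm_inner_le_norm _ _).trans ?_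
    gcongr
    exact A.le_opNorm e
  have hc := hA.1
  rcases (norm_nonneg e).eq_or_lt with h0 | h0
  · rw [← h0]; positivity
  · rw [div_mul_eq_mul_div, le_div_iff₀ hc]
    refine le_of_mul_le_mul_left ?_ h0
    nlinarith

theorem pow_gammaRate_le {β q κ ε : ℝ} (hβ : β ∈ Set.Ico 0 (π / 2)) (hq : 0 < q) (hκ : 0 < κ)
    (hε : 0 < ε) {m : ℕ} (hm : 1 ≤ m) (h : iterationBound β q κ ε ≤ m) :
    12 * q * κ ^ 3 * gammaRate β ^ m ≤ ε := by
  rcases hβ.1.eq_or_lt with rfl | h0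
  -- At `β = 0` the rate is zero, and `1 ≤ m` is needed to exclude `0 ^ 0`.
  · rw [gammaRate_zero, zero_pow (by omega), mul_zero]; exact hε.le
  · obtain ⟨hγ0, hγ1⟩ := gammaRate_mem_Ioo h0 hβ.2
    have hl : 0 < Real.log (1 / gammaRate β) := Real.log_pos (by rwa [lt_div_iff₀ hγ0, one_mul])
    have hK : 0 < 12 * q * κ ^ 3 := by positivity
    rw [iterationBound, inv_mul_le_iff₀ hl, one_div, one_div, Real.log_inv, Real.log_inv] at h
    have hP : 0 < 12 * q * κ ^ 3 * gammaRate β ^ m := by positivity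
    rw [← Real.log_le_log_iff hP hε, Real.log_mul hK.ne' (by positivity), Real.log_pow]
    linarith

theorem ScaledBounds.norm_sub_iterate_le (h : ScaledBounds ψ d C₁ C₂) (hA : IsCoerciveWith A c)
    (hA0 : 0 < ‖A‖) (hC : C₁ ≤ C₂) {β : ℝ} (hβ : β ∈ Set.Ico 0 (π / 2))
    (hcos : Real.cos β = c / ‖A‖ * (C₁ / C₂) ^ 2) {ε : ℝ} (hε : 0 < ε) {m : ℕ} (hm : 1 ≤ m)
    (hbound : iterationBound β (‖A‖ / c) (C₂ / C₁) ε ≤ m) {φ : H} {y y' : Fin n → ℂ}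
    (hy : (scaledMatrix A ψ d).mulVec y = scaledRhs (A φ) ψ d)
    (hy' : IsGMRESIterate (scaledMatrix A ψ d) (scaledRhs (A φ) ψ d) m y') :
    ‖scaledSynth ψ d y - scaledSynth ψ d y'‖ ≤ ε * ‖φ‖ := by
  have hc := hA.1
  have h₁ := h.pos₁
  have h₂ := h.pos₂
  have hres := norm2_residual_le_gammaRate hβ (μ := ‖A‖ * C₂ ^ 2) (c := c * C₁ ^ 2) (by positivity)
    (by positivity) (by rw [hcos]; field_simp) (h.opNorm_le A)
    (fun ξ => h.le_norm_inner hA ξ.ofLp) hy' hm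
  set r := norm2 ((scaledMatrix A ψ d).mulVec y' - scaledRhs (A φ) ψ d) with hr
  have hrhs : norm2 (scaledRhs (A φ) ψ d) ≤ C₂ * (‖A‖ * ‖φ‖) :=
    (h.norm2_scaledRhs_le _).trans (by gcongr; exact A.le_opNorm φ)
  have hdiff : c * C₁ ^ 2 * norm2 (y - y') ≤ r := by
    have h3 := h.mul_norm2_le hA (y - y')
    rw [Matrix.mulVec_sub, hy] at h3
    refine h3.trans (le_of_eq ?_)
    rw [hr, norm2, norm2, ← norm_neg, ← WithLp.toLp_neg, neg_sub]
  have hγ : 0 ≤ gammaRate β := by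
    rcases hβ.1.eq_or_lt with rfl | h0
    · rw [gammaRate_zero]
    · exact (gammaRate_mem_Ioo h0 hβ.2).1.le
  have hpow := pow_gammaRate_le (q := ‖A‖ / c) (κ := C₂ / C₁) hβ (by positivity) (by positivity)
    hε hm hbound
  have hsynth : scaledSynth ψ d y - scaledSynth ψ d y' = scaledSynth ψ d (y - y') := by
    rw [scaledSynth, scaledSynth, scaledSynth, Matrix.mulVec_sub, synth_sub]
  have hκ : 1 ≤ C₂ / C₁ := by rwa [one_le_div h₁]
  rw [hsynth]
  have hn : norm2 (y - y') ≤ r / (c * C₁ ^ 2) := by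
    rw [le_div_iff₀ (by positivity)]; linarith
  have hP : 0 ≤ 12 * gammaRate β ^ m := by positivity
  calc _ ≤ C₂ * norm2 (y - y') := h.upper _
    _ ≤ C₂ * (r / (c * C₁ ^ 2)) := by gcongr
    _ ≤ C₂ * (12 * gammaRate β ^ m * (C₂ * (‖A‖ * ‖φ‖)) / (c * C₁ ^ 2)) := by
        gcongr
        exact hres.trans (by gcongr)
    _ = 12 * (‖A‖ / c) * (C₂ / C₁) ^ 2 * gammaRate β ^ m * ‖φ‖ := by field_simp
    -- The argument produces only the square of `C₂ / C₁`; since this ratio is at least 1, it is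
    -- raised to the cube in the iteration bound.
    _ ≤ 12 * (‖A‖ / c) * (C₂ / C₁) ^ 3 * gammaRate β ^ m * ‖φ‖ := by
        gcongr
        norm_num
    _ ≤ ε * ‖φ‖ := by gcongr

end

end GalerkinGMRES

/-! ### The main theorem. -/

theorem theorem4p12 {H : Type*} [NormedAddCommGroup H] [InnerProductSpace ℂ H] [CompleteSpace H]
    (A : H →L[ℂ] H) (Ccoer : ℝ) (hA : IsCoerciveWith A Ccoer)
    (M : ℕ → ℕ) (hM : ∃ N, 0 < M N) (V : ℕ → Submodule ℂ H)
    (ψ : ∀ N, Module.Basis (Fin (M N)) ℂ (V N))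
    (d : ∀ N, Fin (M N) → ℝ) (C₁ C₂ : ℝ) (hD : NormEquivalence ψ d C₁ C₂) :
    (∃! β : ℝ, β ∈ Set.Ico 0 (π / 2) ∧ Real.cos β = Ccoer / ‖A‖ * (C₁ / C₂) ^ 2) ∧
    (∀ (f : H) (N m : ℕ), 1 ≤ m →
      ∃! y, IsGMRESIterate (scaledMatrix A (ψ N) (d N)) (scaledRhs f (ψ N) (d N)) m y) ∧
    ∀ β ∈ Set.Ico 0 (π / 2), Real.cos β = Ccoer / ‖A‖ * (C₁ / C₂) ^ 2 →
      ∀ ε : ℝ, 0 < ε →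
      ∀ m : ℕ, 1 ≤ m → iterationBound β (‖A‖ / Ccoer) (C₂ / C₁) ε ≤ m →
      ∀ φ f : H, A φ = f → φ ≠ 0 →
      ∀ (N : ℕ) (y : Fin (M N) → ℂ),
        IsGMRESIterate (scaledMatrix A (ψ N) (d N)) (scaledRhs f (ψ N) (d N)) m y →
        ‖φ - synth (ψ N) ((invSqrtDiag (d N)).mulVec y)‖ / ‖φ‖ ≤
          (1 + ε) * (‖A‖ / Ccoer) * (⨅ χ : V N, ‖φ - (χ : H)‖ / ‖φ‖) + ε := by
  have hS := hD.scaledBounds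
  have hc := hA.1
  have h₁ := hD.1
  have h₂ := hD.2.1
  -- A single nonzero vector of one Galerkin space gives both inequalities, which place the
  -- prescribed cosine in `(0, 1]`.
  obtain ⟨hCC, hcA⟩ : C₁ ≤ C₂ ∧ Ccoer ≤ ‖A‖ := by
    obtain ⟨N, hN⟩ := hM
    have hne : (Pi.single ⟨0, hN⟩ 1 : Fin (M N) → ℂ) ≠ 0 := by simp
    have hpos : 0 < norm2 (Pi.single ⟨0, hN⟩ 1 : Fin (M N) → ℂ) :=
      norm_pos_iff.2 fun h0 => hne ((WithLp.toLp_injective 2) (h0.trans (WithLp.toLp_zero 2).symm))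
    set v : Fin (M N) → ℂ := Pi.single ⟨0, hN⟩ 1
    have hl := (hS N).lower v
    have hu := (hS N).upper v
    refine ⟨le_of_mul_le_mul_right (hl.trans hu) hpos, ?_⟩
    set x := scaledSynth (ψ N) (d N) v
    have hx : 0 < ‖x‖ := lt_of_lt_of_le (mul_pos h₁ hpos) hl
    have hxA : Ccoer * ‖x‖ ^ 2 ≤ ‖A‖ * ‖x‖ ^ 2 := by
      calc _ ≤ _ := hA.2 x
        _ ≤ ‖x‖ * ‖A x‖ := norm_inner_le_norm _ _
        _ ≤ ‖x‖ * (‖A‖ * ‖x‖) := by gcongr; exact A.le_opNorm x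
        _ = _ := by ring
    exact le_of_mul_le_mul_right hxA (by positivity)
  have hA0 : 0 < ‖A‖ := lt_of_lt_of_le hc hcA
  refine ⟨?_, fun f N m _ => existsUnique_isGMRESIterate ((hS N).mulVec_injective hA), ?_⟩
  · set t := Ccoer / ‖A‖ * (C₁ / C₂) ^ 2 with ht
    have ht0 : 0 < t := by positivity
    have ht1 : t ≤ 1 :=
      mul_le_one₀ ((div_le_one hA0).2 hcA) (by positivity)
        (pow_le_one₀ (by positivity) ((div_le_one h₂).2 hCC))
    refine ⟨Real.arccos t, ⟨⟨Real.arccos_nonneg t, Real.arccos_lt_pi_div_two.2 ht0⟩,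
      Real.cos_arccos (by linarith) ht1⟩, ?_⟩
    rintro β ⟨hβ, hcos⟩
    rw [← hcos, Real.arccos_cos hβ.1 (by linarith [hβ.2, Real.pi_pos])]
  · rintro β hβ hcos ε hε m hm hbound φ _ rfl hφ N y' hy'
    have hφ0 : 0 < ‖φ‖ := norm_pos_iff.2 hφ
    obtain ⟨y, hy⟩ : ∃ y, (scaledMatrix A (ψ N) (d N)).mulVec y = scaledRhs (A φ) (ψ N) (d N) :=
      (LinearMap.injective_iff_surjective
        (f := (scaledMatrix A (ψ N) (d N)).mulVecLin)).1 ((hS N).mulVec_injective hA) _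
    have hiter := (hS N).norm_sub_iterate_le hA hA0 hCC hβ hcos hε hm hbound hy hy'
    set I := ⨅ χ : V N, ‖φ - (χ : H)‖ / ‖φ‖ with hI
    have hI0 : 0 ≤ I := Real.iInf_nonneg fun χ => by positivity
    have hcea : ‖φ - scaledSynth (ψ N) (d N) y‖ / ‖φ‖ ≤ ‖A‖ / Ccoer * I := by
      have hq : 0 < ‖A‖ / Ccoer := by positivity
      rw [← div_le_iff₀' hq]
      refine le_ciInf fun χ => ?_
      rw [div_le_iff₀' hq, ← mul_div_assoc]
      gcongr
      exact (hS N).norm_sub_galerkin_le hA hy χ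
    have htri : ‖φ - scaledSynth (ψ N) (d N) y'‖ / ‖φ‖ ≤
        ‖φ - scaledSynth (ψ N) (d N) y‖ / ‖φ‖ + ε := by
      rw [div_le_iff₀ hφ0, add_mul, div_mul_cancel₀ _ hφ0.ne']
      calc _ ≤ ‖φ - scaledSynth (ψ N) (d N) y‖ +
            ‖scaledSynth (ψ N) (d N) y - scaledSynth (ψ N) (d N) y'‖ :=
            norm_sub_le_norm_sub_add_norm_sub _ _ _
        _ ≤ _ := by gcongr
    -- Comparing with the exact Galerkin solution already gives the estimate without the factor `1 +
    -- ε`; the extra term is nonnegative.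
    have hε' : 0 ≤ ε * (‖A‖ / Ccoer) * I := by positivity
    calc _ ≤ _ := htri
      _ ≤ ‖A‖ / Ccoer * I + ε := by gcongr
      _ ≤ _ := by linarith
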